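/- Nodes occupy distinct cells of the square grid $\mathbb Z^2$. A shape (a finite set of occupied cells) is connected if the graph of its horizontal and vertical adjacencies is connected and nonempty; it is orthogonal convex if no empty cell lies between two of its nodes in the same row or the same column. A rotation moves a node $u$ by $90^\circ$ around a neighbouring node $v$, from $v+d$ to $v+d'$ with $d\perp d'$ unit vectors, and is allowed iff $v+d'$ and $v+d+d'$ are empty. The perimeter of $S$ consists of the unit sides of nodes of $S$ whose outer cell is empty and not in a hole of $S$. Going around $S$ in a fixed sense, each perimeter side has an outward direction $d$ and a direction of travel $t$. Call a perimeter side of a node $u$ a station if $u+id-jt\notin S$ for all $i\ge 1$, $j\ge 0$ (for $d$ up and $t$ right these are the sides on the horizontal lines of the up-right quadrant of the perimeter, and correspondingly, after rotation or reflection, for the other quadrants and the other sense). The 7-robot in formation on this side is the $2\times 3$ block $\{u+id-jt: i\in\{1,2\},\ j\in\{0,1,2\}\}$ together with one load node behind it, at $u+2d-3t$ (high) or at $u+d-3t$ (low); the two positions have opposite chessboard colours. **Theorem.** Let $S$ be a connected orthogonal convex shape, and fix a sense (clockwise or counterclockwise). Stations exist, and from every station, with the load in either of the two positions (hence whatever the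 colour of the load), the 7-robot in formation can traverse the perimeter of $S$. That is, let $e_0,e_1,\dots,e_m=e_0$ be the sides of the perimeter in cyclic order in the chosen sense, each occurring exactly once among $e_0,\dots,e_{m-1}$, where $e_0$ is the given station. There is a finite sequence of single rotations of robot nodes, around nodes of $S$ or of the robot, with $S$ at rest and the union of $S$ and the robot connected at all times, such that * the robot begins and ends in the given formation on $e_0$; * it visits $e_0,e_1,\dots,e_m$ in this order, at times $0=\tau_0\le\tau_1\le\dots\le\tau_m$ with $\tau_m$ the final time: at time $\tau_i$ it occupies the outer cell of $e_i$, and if $e_i$ is a station it is then in formation on $e_i$ with its load behind it, in one of the two positions; * between the times $\tau_i$ and $\tau_{i+1}$ no robot node lies strictly below the line of cells through the node of $e_i$, where "below" means opposite to the outward direction of $e_i$ (so the robot passes directly from one side to the next and does not take the long way around $S$). -/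

import Mathlib

/-- Cells of the two-dimensional square grid. -/
abbrev Cell : Type := ℤ × ℤ

/-- Two cells are neighbours when they are horizontally or vertically adjacent. -/
def gridGraph : SimpleGraph Cell where
  Adj u v := |u.1 - v.1| + |u.2 - v.2| = 1
  symm := ⟨fun u v h => by rw [abs_sub_comm v.1 u.1, abs_sub_comm v.2 u.2]; exact h⟩
  loopless := ⟨fun u h => by simp at h⟩

/-- A shape (a finite set of occupied cells) is connected when the graph induced on its nodes is
connected; in particular it is nonempty. -/
def ConnectedShape (A : Finset Cell) : Prop :=
  (gridGraph.induce (A : Set Cell)).Connected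

/-- Orthogonal convexity: no empty cell between two nodes of the same column or the same row. -/
def OrthogonalConvex (S : Finset Cell) : Prop :=
  (∀ x y₁ y₂ y : ℤ, (x, y₁) ∈ S → (x, y₂) ∈ S → y₁ < y → y < y₂ → (x, y) ∈ S) ∧
  (∀ y x₁ x₂ x : ℤ, (x₁, y) ∈ S → (x₂, y) ∈ S → x₁ < x → x < x₂ → (x, y) ∈ S)

/-- The four directions of the grid. -/
inductive Dir : Type
  | up
  | right
  | down
  | left

namespace Dir

/-- The unit vector of a direction. -/
def vec : Dir → Cell
  | up => (0, 1)
  | right => (1, 0)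
  | down => (0, -1)
  | left => (-1, 0)

/-- The direction turned by 90 degrees clockwise. -/
def cw : Dir → Dir
  | up => right
  | right => down
  | down => left
  | left => up

/-- The direction turned by 90 degrees counterclockwise. -/
def ccw : Dir → Dir
  | up => left
  | left => down
  | down => right
  | right => up

/-- The opposite direction. -/
def opp (d : Dir) : Dir := d.cw.cw

end Dir

/-! ### Rotations -/

/-- In the shape `A`, the node at `u` can rotate by 90 degrees to the cell `w` around a neighbouring
node `v`: the target `w` and the cell swept on the way are both empty. -/
def CanRotate (A : Finset Cell) (u w : Cell) : Prop :=
  u ∈ A ∧ ∃ v ∈ A, ∃ d d' : Dir, (d' = d.cw ∨ d' = d.ccw) ∧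
    u = v + d.vec ∧ w = v + d'.vec ∧ w ∉ A ∧ v + d.vec + d'.vec ∉ A

/-- With `S` at rest, the robot `R` becomes `R'` by one rotation of one of its own nodes, around a
node of `S` or of the robot. -/
def RobotMove (S R R' : Finset Cell) : Prop :=
  ∃ u ∈ R, ∃ w, CanRotate (S ∪ R) u w ∧ R' = insert w (R.erase u)

/-! ### The perimeter -/

/-- A cell is part of a hole of `A` if every infinite simple grid path from it meets `A`. -/
def InHole (A : Finset Cell) (c : Cell) : Prop :=
  ∀ p : ℕ → Cell, p 0 = c → Function.Injective p →
    (∀ i, gridGraph.Adj (p i) (p (i + 1))) → ∃ i, p i ∈ A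

/-- A side of a cell: the side of `base` that faces the direction `dir`. -/
structure Side : Type where
  base : Cell
  dir : Dir

namespace Side

/-- The cell across the side. -/
def outer (e : Side) : Cell := e.base + e.dir.vec

/-- The direction in which one passes along the outside of `e` when going around the shape, with
`clockwise` deciding the sense. -/
def travel (clockwise : Bool) (e : Side) : Dir :=
  if clockwise then e.dir.cw else e.dir.ccw

end Side

/-- The unit segments of the perimeter of `A`: sides of nodes of `A` whose outer cell is neither
occupied nor part of a hole.  Their outer cells form the cell perimeter. -/
def IsPerimeterSide (A : Finset Cell) (e : Side) : Prop :=
  e.base ∈ A ∧ ¬ InHole A e.outer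

/-- The perimeter side that follows `e`: at a concave corner it lies on the node ahead of the outer
cell, on a straight line it is the same side of the next node, and at a convex corner it is
another side of the same node. -/
def nextSide (S : Finset Cell) (clockwise : Bool) (e : Side) : Side :=
  if e.base + e.dir.vec + (e.travel clockwise).vec ∈ S then
    ⟨e.base + e.dir.vec + (e.travel clockwise).vec, (e.travel clockwise).opp⟩
  else if e.base + (e.travel clockwise).vec ∈ S then
    ⟨e.base + (e.travel clockwise).vec, e.dir⟩
  else ⟨e.base, e.travel clockwise⟩

/-- A station is a perimeter side such that the quarter plane above it (in the direction it
faces) and behind its outer cell (inclusive) contains no node of `S`.  For a connected orthogonal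
convex `S` and up-facing sides passed clockwise, these are the sides on the horizontal lines of the
up-right quadrant of the perimeter, where the robot stands on the shape and moves right; the
remaining sides are those of the vertical lines that it has to climb.  The other directions give
the rotated quadrants. -/
def IsStation (S : Finset Cell) (clockwise : Bool) (e : Side) : Prop :=
  IsPerimeterSide S e ∧
    ∀ i j : ℕ, e.base + (i + 1) • e.dir.vec - j • (e.travel clockwise).vec ∉ S

/-! ### The 7-robot -/

/-- The `2 × 3` block of the robot standing on the side `e`: two layers above `e`, and three
nodes long, from the outer cell of `e` backwards. -/
def block (clockwise : Bool) (e : Side) : Finset Cell :=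
  (({1, 2} : Finset ℕ) ×ˢ ({0, 1, 2} : Finset ℕ)).image
    fun q => e.base + q.1 • e.dir.vec - q.2 • (e.travel clockwise).vec

/-- The cell of the load, directly behind the block, in its upper (`high = true`) or lower
(`high = false`) layer. -/
def loadCell (clockwise : Bool) (e : Side) (high : Bool) : Cell :=
  e.base + (if high then 2 else 1) • e.dir.vec - 3 • (e.travel clockwise).vec

/-- The 7-robot in formation on the side `e`. -/
def sevenRobot (clockwise : Bool) (e : Side) (high : Bool) : Finset Cell :=
  insert (loadCell clockwise e high) (block clockwise e)

/-! ### Traversal -/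

/-- The cell `c` lies on the outer side of the line of cells through `e.base` parallel to `e`, or
on that line. -/
def NotBelow (e : Side) (c : Cell) : Prop :=
  0 ≤ (c.1 - e.base.1) * e.dir.vec.1 + (c.2 - e.base.2) * e.dir.vec.2

/-- The 7-robot that stands in formation on `e` traverses the perimeter of `S` once, in the sense
given by `clockwise`.  The sides `(nextSide S clockwise)^[i] e`, `i < m`, are the whole perimeter,
each occurring once, in cyclic order.  `ρ s` is the robot after `s` rotations, and `τ i` is the time
of its visit to the `i`-th side. The last clause makes the robot pass from one side to the next
directly rather than the long way around the shape. -/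
def TraversesPerimeter (S : Finset Cell) (clockwise : Bool) (e : Side) (high : Bool) : Prop :=
  ∃ (m T : ℕ) (τ : ℕ → ℕ) (ρ : ℕ → Finset Cell),
    -- the perimeter, as a cyclic sequence of sides
    (nextSide S clockwise)^[m] e = e ∧
    (∀ i, IsPerimeterSide S ((nextSide S clockwise)^[i] e)) ∧
    (∀ f, IsPerimeterSide S f → ∃! i, i < m ∧ (nextSide S clockwise)^[i] e = f) ∧
    -- the robot moves by rotations, the whole shape staying connected, and ends as it began
    ρ 0 = sevenRobot clockwise e high ∧
    ρ T = sevenRobot clockwise e high ∧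
    (∀ s < T, RobotMove S (ρ s) (ρ (s + 1))) ∧
    (∀ s ≤ T, Disjoint S (ρ s) ∧ ConnectedShape (S ∪ ρ s)) ∧
    -- it visits the sides in their order
    τ 0 = 0 ∧ τ m = T ∧ (∀ i < m, τ i ≤ τ (i + 1)) ∧
    (∀ i ≤ m, ((nextSide S clockwise)^[i] e).outer ∈ ρ (τ i)) ∧
    -- at every station it is back in formation, with the load behind
    (∀ i ≤ m, IsStation S clockwise ((nextSide S clockwise)^[i] e) →
      ∃ high' : Bool, ρ (τ i) = sevenRobot clockwise ((nextSide S clockwise)^[i] e) high') ∧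
    -- between two visits it never goes below the side just visited
    (∀ i < m, ∀ s, τ i ≤ s → s ≤ τ (i + 1) → ∀ c ∈ ρ s,
      NotBelow ((nextSide S clockwise)^[i] e) c)

/-! All local arguments take place in the frame of a side (`Side.place`), with travel as first axis
and the outward direction as second, so that the four directions and both senses become one case.
The invariant is `Ready`: on a station the robot is in formation, and on any other side it has the
same formation lifted along the wall, with no floor needed under it. Passing a concave corner then
takes no motion. The remaining passages (straight step, convex turn, climb, top of a wall) are
explicit lists of rotations, checked by evaluation for given support cells and a region of empty
cells (`CheckedRun`) and carried to the grid by `CheckedRun.robotPath`.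

The empty regions come from connectedness and orthogonal convexity. Over a perimeter side, the
quadrant behind or the quadrant ahead is empty (`ConvexRegion.empty_behind_or_ahead`): stations are
the first case, so at a non-station the quadrant ahead is empty and the robot has room to climb.

The perimeter is one cycle. `nextSide` is injective on the finitely many sides, so each of them is
periodic. From any side a potential increases along an ascent (`OnAscent.next`) until a convex
corner at a station is reached. There is exactly one such corner for each direction, and each leads
to the next, so all sides reach the same corner and hence each other.

Finally, rotations preserve chessboard colours, so after a full lap the load is in its initial
position. -/

/-! ### Coordinates in the frame of a side -/

namespace Side

/-- The cell with coordinates `c` in the frame of the side `f`: the first coordinate runs along the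
direction of travel, the second one along the outward direction, and the origin is `f.base`. -/
def place (clockwise : Bool) (f : Side) (c : Cell) : Cell :=
  f.base + c.1 • (f.travel clockwise).vec + c.2 • f.dir.vec

variable (cw : Bool) (f : Side)

theorem place_zero : f.place cw (0, 0) = f.base := by
  simp [place]

theorem place_outer : f.place cw (0, 1) = f.outer := by
  simp [place, outer]

theorem place_injective : Function.Injective (f.place cw) := by
  rintro ⟨a, b⟩ ⟨a', b'⟩ h
  obtain ⟨⟨x, y⟩, d⟩ := f
  cases d <;> cases cw <;> simp [place, travel, Dir.vec, Dir.cw, Dir.ccw] at h <;>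
    simp only [Prod.mk.injEq] <;> omega

theorem place_surjective : Function.Surjective (f.place cw) := by
  rintro ⟨a, b⟩
  obtain ⟨⟨x, y⟩, d⟩ := f
  cases d <;> cases cw
  · exact ⟨(x - a, b - y), by simp [place, travel, Dir.vec, Dir.ccw]⟩
  · exact ⟨(a - x, b - y), by simp [place, travel, Dir.vec, Dir.cw]⟩
  · exact ⟨(b - y, a - x), by simp [place, travel, Dir.vec, Dir.ccw]⟩
  · exact ⟨(y - b, a - x), by simp [place, travel, Dir.vec, Dir.cw]⟩
  · exact ⟨(a - x, y - b), by simp [place, travel, Dir.vec, Dir.ccw]⟩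
  · exact ⟨(x - a, y - b), by simp [place, travel, Dir.vec, Dir.cw]⟩
  · exact ⟨(y - b, x - a), by simp [place, travel, Dir.vec, Dir.ccw]⟩
  · exact ⟨(b - y, x - a), by simp [place, travel, Dir.vec, Dir.cw]⟩

theorem adj_place_iff (a b : Cell) :
    gridGraph.Adj (f.place cw a) (f.place cw b) ↔ gridGraph.Adj a b := by
  obtain ⟨a₁, a₂⟩ := a
  obtain ⟨b₁, b₂⟩ := b
  obtain ⟨⟨x, y⟩, d⟩ := f
  cases d <;> cases cw <;>
    simp [place, travel, Dir.vec, Dir.cw, Dir.ccw, gridGraph] <;>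
    simp only [abs_eq_max_neg] <;> omega

/-- The direction that is called `d` in the frame of the side `f`. -/
def frameDir : Dir → Dir
  | .up => f.dir
  | .right => f.travel cw
  | .down => f.dir.opp
  | .left => (f.travel cw).opp

theorem place_add_vec (c : Cell) (d : Dir) :
    f.place cw (c + d.vec) = f.place cw c + (f.frameDir cw d).vec := by
  obtain ⟨⟨x, y⟩, e⟩ := f
  cases d <;> cases e <;> cases cw <;>
    simp [place, frameDir, travel, Dir.vec, Dir.cw, Dir.ccw, Dir.opp] <;> ring

/-- For the counterclockwise sense the frame reverses orientation and exchanges the two kinds of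
quarter turn; only the disjunction is invariant. -/
theorem frameDir_cw_or_ccw {d d' : Dir} (h : d' = d.cw ∨ d' = d.ccw) :
    f.frameDir cw d' = (f.frameDir cw d).cw ∨ f.frameDir cw d' = (f.frameDir cw d).ccw := by
  obtain ⟨b, e⟩ := f
  rcases h with rfl | rfl <;> cases d <;> cases e <;> cases cw <;>
    simp [frameDir, travel, Dir.cw, Dir.ccw, Dir.opp]

theorem place_shift (p c : Cell) :
    (Side.mk (f.place cw p) f.dir).place cw c = f.place cw (p + c) := by
  simp [place, travel, add_smul]
  abel

/-- A side at a convex corner faces the old direction of travel, and its own travel is the old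
inward direction. -/
theorem place_turn (p c : Cell) :
    (Side.mk (f.place cw p) (f.travel cw)).place cw c = f.place cw (p + (c.2, -c.1)) := by
  obtain ⟨⟨x, y⟩, e⟩ := f
  cases e <;> cases cw <;>
    simp [place, travel, Dir.vec, Dir.cw, Dir.ccw] <;> ring_nf <;> trivial

theorem place_turn_opp (p c : Cell) :
    (Side.mk (f.place cw p) (f.travel cw).opp).place cw c = f.place cw (p + (-c.2, c.1)) := by
  obtain ⟨⟨x, y⟩, e⟩ := f
  cases e <;> cases cw <;>
    simp [place, travel, Dir.vec, Dir.cw, Dir.ccw, Dir.opp] <;> ring_nf <;> trivial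

theorem travel_turn_opp (p : Cell) : (Side.mk p (f.travel cw).opp).travel cw = f.dir := by
  obtain ⟨b, e⟩ := f
  cases e <;> cases cw <;> rfl

/-- In the frame of the side `f`, the cells on or above the line of `f` are those with nonnegative
second coordinate. -/
theorem notBelow_place (c : Cell) : NotBelow f (f.place cw c) ↔ 0 ≤ c.2 := by
  obtain ⟨⟨x, y⟩, e⟩ := f
  cases e <;> cases cw <;> simp [NotBelow, place, travel, Dir.vec, Dir.cw, Dir.ccw]

/-- For the side `e` of a wall, the side of the floor from which the robot climbs the wall when the
node of `e` is the lowest one of the wall. -/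
def floor (e : Side) : Side := ⟨e.place cw (-1, 1), e.travel cw⟩

theorem place_floor (c : Cell) : (f.floor cw).place cw c = f.place cw (c.2 - 1, 1 - c.1) := by
  rw [floor, place_turn]
  congr 1
  ext <;> simp <;> ring

end Side

/-! ### Rotations in frame coordinates, in decidable form -/

/-- The 7-robot in formation on the upper side of the origin, moving right. -/
def standardRobot (high : Bool) : Finset Cell :=
  {(-3, if high then 2 else 1), (0, 1), (-1, 1), (-2, 1), (0, 2), (-1, 2), (-2, 2)}

theorem sevenRobot_eq_image (cw : Bool) (f : Side) (high : Bool) :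
    sevenRobot cw f high = (standardRobot high).image (f.place cw) := by
  have hblock : ({1, 2} : Finset ℕ) ×ˢ ({0, 1, 2} : Finset ℕ) =
      {(1, 0), (1, 1), (1, 2), (2, 0), (2, 1), (2, 2)} := rfl
  rw [sevenRobot, block, hblock, standardRobot]
  simp only [Finset.image_insert, Finset.image_singleton]
  refine congrArg₂ _ ?_ (congrArg₂ _ ?_ (congrArg₂ _ ?_ (congrArg₂ _ ?_ (congrArg₂ _ ?_
    (congrArg₂ _ ?_ (congrArg _ ?_)))))) <;>
  · obtain ⟨⟨x, y⟩, e⟩ := f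
    cases e <;> cases cw <;> cases high <;>
      simp [loadCell, Side.place, Side.travel, Dir.vec, Dir.cw, Dir.ccw] <;> ring

/-- A single rotation: the node at `pivot + dir` moves around `pivot`, clockwise if `turn`. -/
structure Rotation : Type where
  pivot : Cell
  dir : Dir
  turn : Bool

namespace Rotation

variable (r : Rotation)

/-- The direction of the rotating node after the rotation. -/
def newDir : Dir := if r.turn then r.dir.cw else r.dir.ccw

/-- The cell from which the rotating node starts. -/
def source : Cell := r.pivot + r.dir.vec

/-- The cell at which the rotating node arrives. -/
def target : Cell := r.pivot + r.newDir.vec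

/-- The cell that the rotating node sweeps on the way. -/
def swept : Cell := r.pivot + r.dir.vec + r.newDir.vec

/-- The robot after the rotation. -/
def apply (R : Finset Cell) : Finset Cell := insert r.target (R.erase r.source)

/-- The rotation is possible for the robot `R` supported by the occupied cells `sup`, when all cells
that satisfy `free` are known to be empty of other nodes. -/
def Legal (sup : Finset Cell) (free : Cell → Prop) (R : Finset Cell) : Prop :=
  r.source ∈ R ∧ r.pivot ∈ R ∪ sup ∧ r.target ∉ R ∧ r.swept ∉ R ∧ free r.target ∧ free r.swept

instance (sup : Finset Cell) (free : Cell → Prop) [DecidablePred free] (R : Finset Cell) :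
    Decidable (r.Legal sup free R) := by
  unfold Legal; infer_instance

end Rotation

/-- The cells of `R` that are adjacent to a cell of `X` or of `sup`. -/
def growFrom (sup R X : Finset Cell) : Finset Cell :=
  R.filter fun c => ∃ d ∈ [Dir.up, Dir.right, Dir.down, Dir.left], c + d.vec ∈ X ∪ sup

/-- Every cell of `R` is joined to `sup` by a path of at most seven steps in `R`. -/
def Anchored (sup R : Finset Cell) : Prop := R ⊆ (growFrom sup R)^[7] ∅

instance (sup R : Finset Cell) : Decidable (Anchored sup R) := by
  unfold Anchored; infer_instance

/-- The list of rotations is possible and takes the robot `R` to `R'`. -/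
def LegalRun (sup : Finset Cell) (free : Cell → Prop) :
    List Rotation → Finset Cell → Finset Cell → Prop
  | [], R, R' => R = R'
  | r :: l, R, R' => r.Legal sup free R ∧ Anchored sup (r.apply R) ∧
      LegalRun sup free l (r.apply R) R'

instance decidableLegalRun (sup : Finset Cell) (free : Cell → Prop) [DecidablePred free] :
    ∀ (l : List Rotation) (R R' : Finset Cell), Decidable (LegalRun sup free l R R')
  | [], R, R' => inferInstanceAs (Decidable (R = R'))
  | r :: l, R, R' =>
    haveI := decidableLegalRun sup free l (r.apply R) R'
    inferInstanceAs (Decidable (_ ∧ _ ∧ _))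

/-! ### Paths of robots -/

/-- The robot can move from `R` to `R'` by rotations, satisfying `P` at all times. -/
def RobotPath (S : Finset Cell) (P : Finset Cell → Prop) (R R' : Finset Cell) : Prop :=
  ∃ (n : ℕ) (ρ : ℕ → Finset Cell), ρ 0 = R ∧ ρ n = R' ∧
    (∀ s < n, RobotMove S (ρ s) (ρ (s + 1))) ∧ ∀ s ≤ n, P (ρ s)

theorem RobotPath.refl {S : Finset Cell} {P : Finset Cell → Prop} {R : Finset Cell} (h : P R) :
    RobotPath S P R R :=
  ⟨0, fun _ => R, rfl, rfl, by simp, fun _ _ => h⟩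

theorem RobotPath.cons {S : Finset Cell} {P : Finset Cell → Prop} {R R' R'' : Finset Cell}
    (h : P R) (hm : RobotMove S R R') (hp : RobotPath S P R' R'') : RobotPath S P R R'' := by
  obtain ⟨n, ρ, h0, hn, hmove, hP⟩ := hp
  refine ⟨n + 1, fun s => Nat.casesOn s R ρ, rfl, hn, ?_, ?_⟩
  · rintro (_ | s) hs
    · simpa [h0] using hm
    · exact hmove s (by omega)
  · rintro (_ | s) hs
    · exact h
    · exact hP s (by omega)

/-- Paths between consecutive terms of a sequence of robots can be joined. -/
theorem RobotPath.join {S : Finset Cell} (Q : Finset Cell → Prop) (P : ℕ → Finset Cell → Prop)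
    (R : ℕ → Finset Cell) (hPQ : ∀ i X, P i X → Q X) (h0 : Q (R 0)) (m : ℕ)
    (h : ∀ i < m, RobotPath S (P i) (R i) (R (i + 1))) :
    ∃ (T : ℕ) (τ : ℕ → ℕ) (ρ : ℕ → Finset Cell), τ 0 = 0 ∧ τ m = T ∧
      (∀ i < m, τ i ≤ τ (i + 1)) ∧ (∀ i ≤ m, ρ (τ i) = R i) ∧
      (∀ s < T, RobotMove S (ρ s) (ρ (s + 1))) ∧ (∀ s ≤ T, Q (ρ s)) ∧
      (∀ i < m, ∀ s, τ i ≤ s → s ≤ τ (i + 1) → P i (ρ s)) := by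
  induction m with
  | zero =>
    exact ⟨0, fun _ => 0, fun _ => R 0, rfl, rfl, by simp, by simp, by simp,
      fun _ _ => h0, by simp⟩
  | succ m ih =>
    obtain ⟨T, τ, ρ, hτ0, hτm, hmono, hR, hmove, hQ, hP⟩ := ih fun i hi => h i (by omega)
    obtain ⟨n, σ, hσ0, hσn, hσmove, hσP⟩ := h m (by omega)
    have hτT : ∀ i ≤ m, τ i ≤ T := by
      intro i hi
      rw [← hτm]
      clear * - hi hmono
      induction m, hi using Nat.le_induction with
      | base => exact le_rfl
      | succ k hk ih' => exact (ih' fun i hi => hmono i (by omega)).trans (hmono k (by omega))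
    -- The two runs agree at the joining time `T`, so there either branch of the definition by cases
    -- may be used.
    have hjoin : ρ T = σ 0 := by rw [hσ0, ← hτm, hR m le_rfl]
    have hσ : ∀ s, T ≤ s → (if s ≤ T then ρ s else σ (s - T)) = σ (s - T) := by
      intro s hs
      split_ifs with h'
      · obtain rfl : s = T := by omega
        simpa using hjoin
      · rfl
    have hτ' : ∀ i ≤ m, (if i ≤ m then τ i else T + n) = τ i := fun i hi => if_pos hi
    refine ⟨T + n, fun i => if i ≤ m then τ i else T + n, fun s => if s ≤ T then ρ s else σ (s - T),
      by simpa using hτ0, by simp, ?_, ?_, ?_, ?_, ?_⟩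
    · intro i hi
      rcases Nat.lt_or_ge i m with h' | h'
      · simpa [h'.le, Nat.succ_le_of_lt h'] using hmono i h'
      · obtain rfl : i = m := by omega
        simp [hτm]
    · intro i hi
      rcases Nat.lt_or_ge m i with h' | h'
      · obtain rfl : i = m + 1 := by omega
        simpa [hσn] using hσ (T + n) (by omega)
      · simpa [h', hτT i h'] using hR i h'
    · intro s hs
      rcases Nat.lt_or_ge s T with h' | h'
      · simpa [h'.le, Nat.succ_le_of_lt h'] using hmove s h'
      · have := hσmove (s - T) (by omega)
        simp only [hσ s h', hσ (s + 1) (by omega)]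
        rwa [show s + 1 - T = s - T + 1 by omega]
    · intro s hs
      rcases Nat.le_total s T with h' | h'
      · simpa [h'] using hQ s h'
      · simp only [hσ s h']
        exact hPQ m _ (hσP _ (by omega))
    · intro i hi s h1 h2
      rcases Nat.lt_or_ge i m with h' | h'
      · simp only [hτ' i h'.le, hτ' (i + 1) h'] at h1 h2
        simpa [h2.trans (hτT _ h')] using hP i h' s h1 h2
      · obtain rfl : i = m := by omega
        simp only [le_refl, if_true, hτm] at h1
        simp only [Nat.not_succ_le_self, if_false] at h2
        simp only [hσ s h1]
        exact hσP _ (by omega)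

/-! ### From the frame of a side to the grid -/

/-- Since `S` is connected, it is enough that every robot node has a path to `S`. -/
theorem connectedShape_union {S R : Finset Cell} (hS : ConnectedShape S)
    (h : ∀ c ∈ R, ∃ s ∈ S, Relation.ReflTransGen
      (fun a b => gridGraph.Adj a b ∧ b ∈ S ∪ R) c s) :
    ConnectedShape (S ∪ R) := by
  have key : ∀ c (hc : c ∈ S ∪ R), ∃ s, ∃ hs : s ∈ S,
      (gridGraph.induce ((S ∪ R : Finset Cell) : Set Cell)).Reachable ⟨c, hc⟩
        ⟨s, Finset.mem_union_left _ hs⟩ := by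
    intro c hc
    rcases Finset.mem_union.1 hc with hcS | hcR
    · exact ⟨c, hcS, .refl _⟩
    · obtain ⟨s, hs, hcs⟩ := h c hcR
      refine ⟨s, hs, ?_⟩
      clear hcR
      induction hcs using Relation.ReflTransGen.head_induction_on with
      | refl => exact .refl _
      | head hab _ ih =>
        refine .trans (SimpleGraph.Adj.reachable ?_) (ih hab.2)
        simpa using hab.1
  obtain ⟨⟨s₀, hs₀⟩⟩ := hS.nonempty
  refine (SimpleGraph.connected_iff_exists_forall_reachable _).2
    ⟨⟨s₀, Finset.mem_union_left _ hs₀⟩, ?_⟩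
  rintro ⟨c, hc⟩
  obtain ⟨s, hs, hcs⟩ := key c hc
  refine .trans ?_ hcs.symm
  have := hS.preconnected ⟨s₀, hs₀⟩ ⟨s, hs⟩
  exact this.map (SimpleGraph.induceHomOfLE _ (by simp)).toHom

theorem adj_add_vec (c : Cell) (d : Dir) : gridGraph.Adj c (c + d.vec) := by
  cases d <;> simp [gridGraph, Dir.vec]

section Place

variable {S sup : Finset Cell} {cw : Bool} {f : Side}

/-- Growth starts from the empty set, so the first layer touches `sup` and each later one touches
`sup` or an earlier layer; following the layers back gives the path. -/
theorem reflTransGen_of_mem_iterate_growFrom {R : Finset Cell}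
    (hsup : ∀ c ∈ sup, f.place cw c ∈ S) (n : ℕ) :
    ∀ c ∈ (growFrom sup R)^[n] ∅, c ∈ R ∧ ∃ s ∈ S, Relation.ReflTransGen
      (fun a b => gridGraph.Adj a b ∧ b ∈ S ∪ R.image (f.place cw)) (f.place cw c) s := by
  induction n with
  | zero => simp
  | succ n ih =>
    intro c hc
    rw [Function.iterate_succ_apply', growFrom, Finset.mem_filter] at hc
    obtain ⟨hcR, d, -, hd⟩ := hc
    have hadj : gridGraph.Adj (f.place cw c) (f.place cw (c + d.vec)) :=
      (f.adj_place_iff cw _ _).2 (adj_add_vec c d)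
    refine ⟨hcR, ?_⟩
    rcases Finset.mem_union.1 hd with hd | hd
    · obtain ⟨hdR, s, hs, hrel⟩ := ih _ hd
      exact ⟨s, hs, .head ⟨hadj, Finset.mem_union_right _ (Finset.mem_image_of_mem _ hdR)⟩ hrel⟩
    · exact ⟨_, hsup _ hd, .single ⟨hadj, Finset.mem_union_left _ (hsup _ hd)⟩⟩

theorem Anchored.connectedShape_union {R : Finset Cell} (hR : Anchored sup R)
    (hS : ConnectedShape S) (hsup : ∀ c ∈ sup, f.place cw c ∈ S) :
    ConnectedShape (S ∪ R.image (f.place cw)) := by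
  refine _root_.connectedShape_union hS fun c hc => ?_
  obtain ⟨c', hc', rfl⟩ := Finset.mem_image.1 hc
  exact (reflTransGen_of_mem_iterate_growFrom hsup 7 c' (hR hc')).2

variable {free : Cell → Prop}

theorem Rotation.Legal.robotMove {r : Rotation} {R : Finset Cell} (h : r.Legal sup free R)
    (hsup : ∀ c ∈ sup, f.place cw c ∈ S) (hfree : ∀ c, free c → f.place cw c ∉ S) :
    RobotMove S (R.image (f.place cw)) ((r.apply R).image (f.place cw)) := by
  obtain ⟨hsource, hpivot, htarget, hswept, hfreet, hfrees⟩ := h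
  have hinj := f.place_injective cw
  refine ⟨f.place cw r.source, Finset.mem_image_of_mem _ hsource, f.place cw r.target,
    ⟨Finset.mem_union_right _ (Finset.mem_image_of_mem _ hsource), f.place cw r.pivot, ?_,
      f.frameDir cw r.dir, f.frameDir cw r.newDir, ?_, f.place_add_vec cw _ _,
      f.place_add_vec cw _ _, ?_, ?_⟩, ?_⟩
  · rcases Finset.mem_union.1 hpivot with hp | hp
    · exact Finset.mem_union_right _ (Finset.mem_image_of_mem _ hp)
    · exact Finset.mem_union_left _ (hsup _ hp)
  · apply f.frameDir_cw_or_ccw cw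
    unfold newDir
    split_ifs <;> simp
  · simp [hinj.eq_iff, hfree _ hfreet, htarget]
  · rw [← f.place_add_vec, ← f.place_add_vec]
    have := hfree _ hfrees
    rw [swept] at this hswept
    simp [hinj.eq_iff, this, hswept]
  · rw [apply, Finset.image_insert, Finset.image_erase hinj]

/-- A robot that is disjoint from `S`, connected with it, and does not go below the side `e`. -/
def Sound (S : Finset Cell) (e : Side) (X : Finset Cell) : Prop :=
  (Disjoint S X ∧ ConnectedShape (S ∪ X)) ∧ ∀ c ∈ X, NotBelow e c

theorem Anchored.sound {R : Finset Cell} {e : Side} (hR : Anchored sup R)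
    (hS : ConnectedShape S) (hsup : ∀ c ∈ sup, f.place cw c ∈ S)
    (hfree : ∀ c, free c → f.place cw c ∉ S) (hbelow : ∀ c, free c → NotBelow e (f.place cw c))
    (hRfree : ∀ c ∈ R, free c) : Sound S e (R.image (f.place cw)) := by
  refine ⟨⟨?_, hR.connectedShape_union hS hsup⟩, ?_⟩
  · rw [Finset.disjoint_right]
    intro c hc
    obtain ⟨c', hc', rfl⟩ := Finset.mem_image.1 hc
    exact hfree c' (hRfree c' hc')
  · intro c hc
    obtain ⟨c', hc', rfl⟩ := Finset.mem_image.1 hc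
    exact hbelow c' (hRfree c' hc')

/-- A run of rotations that is legal in the frame of the side `f` gives a path of the robot. -/
theorem LegalRun.robotPath {e : Side} (hS : ConnectedShape S)
    (hsup : ∀ c ∈ sup, f.place cw c ∈ S)
    (hfree : ∀ c, free c → f.place cw c ∉ S) (hbelow : ∀ c, free c → NotBelow e (f.place cw c))
    (l : List Rotation) {R R' : Finset Cell} (hR : Anchored sup R) (hRfree : ∀ c ∈ R, free c)
    (h : LegalRun sup free l R R') :
    RobotPath S (Sound S e) (R.image (f.place cw)) (R'.image (f.place cw)) := by
  induction l generalizing R with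
  | nil =>
    obtain rfl : R = R' := h
    exact .refl (hR.sound hS hsup hfree hbelow hRfree)
  | cons r l ih =>
    obtain ⟨hlegal, hanch, hrun⟩ := h
    refine .cons (hR.sound hS hsup hfree hbelow hRfree) (hlegal.robotMove hsup hfree)
      (ih hanch ?_ hrun)
    intro c hc
    rcases Finset.mem_insert.1 hc with rfl | hc
    · exact hlegal.2.2.2.2.1
    · exact hRfree c (Finset.mem_of_mem_erase hc)

end Place

/-! ### The runs of rotations of the traversal -/

/-- A run of rotations from one robot to another that can be checked by evaluation. -/
def CheckedRun (sup : Finset Cell) (free : Cell → Prop) (l : List Rotation)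
    (R R' : Finset Cell) : Prop :=
  Anchored sup R ∧ (∀ c ∈ R, free c) ∧ LegalRun sup free l R R'

instance (sup : Finset Cell) (free : Cell → Prop) [DecidablePred free] (l : List Rotation)
    (R R' : Finset Cell) : Decidable (CheckedRun sup free l R R') := by
  unfold CheckedRun; infer_instance

theorem CheckedRun.robotPath {S sup : Finset Cell} {free : Cell → Prop} {l : List Rotation}
    {R R' : Finset Cell} (h : CheckedRun sup free l R R') (cw : Bool) (f : Side) {e : Side}
    (hS : ConnectedShape S) (hsup : ∀ c ∈ sup, f.place cw c ∈ S)
    (hfree : ∀ c, free c → f.place cw c ∉ S) (hbelow : ∀ c, free c → NotBelow e (f.place cw c)) :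
    RobotPath S (Sound S e) (R.image (f.place cw)) (R'.image (f.place cw)) :=
  h.2.2.robotPath hS hsup hfree hbelow l h.1 h.2.1

/-- After the front lower node has left, the robot rests on the cell `(-1, 0)`, so this run needs a
node of `S` there. -/
theorem exists_checkedRun_step_high_of_floor : ∃ l, CheckedRun {(-1, 0), (0, 0), (1, 0)}
    (fun c => c.1 ≤ 1 ∧ 1 ≤ c.2)
    l (standardRobot true) ((standardRobot false).image ((1, 0) + ·)) :=
  ⟨[⟨(0, 2), .down, false⟩, ⟨(1, 2), .left, false⟩, ⟨(-1, 1), .up, true⟩,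
    ⟨(-2, 2), .left, true⟩, ⟨(-2, 2), .up, true⟩, ⟨(-1, 2), .left, true⟩,
    ⟨(-1, 2), .up, true⟩],
   by decide +kernel⟩

/-- The complementary case: with nothing behind the origin in its row, a robot node can dip to `(-1,
0)`. -/
theorem exists_checkedRun_step_high_of_free : ∃ l, CheckedRun {(0, 0), (1, 0)}
    (fun c => c.1 ≤ 1 ∧ 1 ≤ c.2 ∨ c.1 ≤ -1 ∧ 0 ≤ c.2)
    l (standardRobot true) ((standardRobot false).image ((1, 0) + ·)) :=
  ⟨[⟨(0, 1), .up, true⟩, ⟨(-1, 1), .left, false⟩, ⟨(-2, 2), .left, false⟩,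
    ⟨(-1, 2), .left, true⟩, ⟨(-1, 2), .up, true⟩, ⟨(0, 2), .left, true⟩, ⟨(0, 2), .up, true⟩,
    ⟨(-1, 1), .left, true⟩, ⟨(-1, 1), .down, true⟩],
   by decide +kernel⟩

theorem exists_checkedRun_step_low : ∃ l, CheckedRun {(0, 0), (1, 0)}
    (fun c => c.1 ≤ 1 ∧ 1 ≤ c.2)
    l (standardRobot false) ((standardRobot true).image ((1, 0) + ·)) :=
  ⟨[⟨(-1, 2), .left, true⟩, ⟨(-2, 1), .left, true⟩, ⟨(-2, 2), .down, true⟩,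
    ⟨(-2, 2), .left, true⟩, ⟨(-1, 3), .left, true⟩, ⟨(-1, 3), .up, true⟩,
    ⟨(0, 3), .left, true⟩, ⟨(-1, 2), .left, true⟩, ⟨(0, 1), .up, true⟩, ⟨(0, 3), .up, true⟩,
    ⟨(1, 3), .left, false⟩, ⟨(-1, 2), .up, false⟩, ⟨(1, 2), .up, false⟩],
   by decide +kernel⟩

theorem exists_checkedRun_climb_high : ∃ l, CheckedRun {(1, 1), (1, 2)}
    (fun c => c.1 ≤ 0 ∧ 1 ≤ c.2)
    l (standardRobot true) ((standardRobot false).image ((0, 1) + ·)) :=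
  ⟨[⟨(0, 2), .left, true⟩, ⟨(-2, 2), .left, true⟩, ⟨(-2, 3), .down, false⟩,
    ⟨(-2, 1), .right, false⟩, ⟨(0, 2), .down, true⟩, ⟨(-2, 2), .down, true⟩],
   by decide +kernel⟩

/-- For a moment the robot hangs on `(1, 3)` alone, which must therefore be occupied. -/
theorem exists_checkedRun_climb_low_of_wall : ∃ l, CheckedRun {(1, 1), (1, 2), (1, 3)}
    (fun c => c.1 ≤ 0 ∧ 1 ≤ c.2)
    l (standardRobot false) ((standardRobot true).image ((0, 1) + ·)) :=
  ⟨[⟨(-1, 2), .left, true⟩, ⟨(-2, 1), .left, true⟩, ⟨(-2, 2), .down, true⟩,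
    ⟨(-2, 2), .left, true⟩, ⟨(-2, 3), .right, false⟩, ⟨(-1, 2), .right, false⟩,
    ⟨(-2, 3), .up, false⟩, ⟨(-1, 3), .down, false⟩, ⟨(-1, 1), .right, false⟩,
    ⟨(-1, 2), .down, false⟩],
   by decide +kernel⟩

/-- Here the wall ends at `(1, 2)`, and a robot node is parked at `(1, 3)` during the run. -/
theorem exists_checkedRun_climb_low_of_free : ∃ l, CheckedRun {(1, 1), (1, 2)}
    (fun c => c.1 ≤ 0 ∧ 1 ≤ c.2 ∨ c.1 = 1 ∧ 3 ≤ c.2)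
    l (standardRobot false) ((standardRobot true).image ((0, 1) + ·)) :=
  ⟨[⟨(1, 2), .left, true⟩, ⟨(-1, 2), .left, true⟩, ⟨(-2, 1), .left, true⟩,
    ⟨(-1, 3), .down, false⟩, ⟨(-1, 1), .right, false⟩, ⟨(-2, 2), .down, true⟩,
    ⟨(-2, 2), .left, true⟩, ⟨(-1, 2), .down, false⟩, ⟨(-2, 3), .right, false⟩,
    ⟨(-2, 3), .up, false⟩, ⟨(0, 3), .right, false⟩, ⟨(0, 3), .up, false⟩],
   by decide +kernel⟩

theorem exists_checkedRun_top_high : ∃ l, CheckedRun {(1, 1)}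
    (fun c => c.1 ≤ 0 ∧ 1 ≤ c.2 ∨ c.1 = 1 ∧ 2 ≤ c.2)
    l (standardRobot true) ((standardRobot true).image ((1, 1) + ·)) :=
  ⟨[⟨(0, 2), .left, true⟩, ⟨(-2, 2), .left, true⟩, ⟨(-2, 3), .down, false⟩,
    ⟨(-1, 1), .left, true⟩, ⟨(0, 3), .down, false⟩, ⟨(1, 1), .left, true⟩,
    ⟨(-1, 2), .down, false⟩],
   by decide +kernel⟩

theorem exists_checkedRun_top_low : ∃ l, CheckedRun {(1, 1)}
    (fun c => c.1 ≤ 0 ∧ 1 ≤ c.2 ∨ c.1 = 1 ∧ 2 ≤ c.2)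
    l (standardRobot false) ((standardRobot false).image ((1, 1) + ·)) :=
  ⟨[⟨(-1, 2), .left, true⟩, ⟨(-2, 1), .left, true⟩, ⟨(-2, 2), .down, true⟩,
    ⟨(-2, 2), .left, true⟩, ⟨(-1, 3), .left, true⟩, ⟨(-1, 3), .up, true⟩,
    ⟨(0, 3), .down, false⟩, ⟨(1, 1), .left, true⟩, ⟨(-1, 2), .down, false⟩],
   by decide +kernel⟩

/-- The corner node is the only support, so the turn works even for a shape one cell thick. -/
theorem exists_checkedRun_turn_high : ∃ l, CheckedRun {(0, 0)}
    (fun c => 1 ≤ c.2 ∨ 1 ≤ c.1 ∧ 0 ≤ c.2)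
    l (standardRobot true) ((standardRobot true).image fun c => (c.2, -c.1)) :=
  ⟨[⟨(0, 2), .left, true⟩, ⟨(-2, 2), .left, true⟩, ⟨(-2, 3), .down, false⟩,
    ⟨(-1, 3), .left, true⟩, ⟨(-1, 1), .left, true⟩, ⟨(-1, 2), .down, true⟩,
    ⟨(0, 2), .up, true⟩, ⟨(-1, 3), .up, true⟩, ⟨(0, 3), .left, true⟩, ⟨(-1, 2), .left, true⟩,
    ⟨(0, 3), .up, true⟩, ⟨(0, 3), .left, true⟩, ⟨(1, 2), .up, true⟩, ⟨(0, 3), .up, true⟩,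
    ⟨(1, 2), .right, true⟩, ⟨(1, 3), .left, true⟩, ⟨(0, 2), .left, true⟩, ⟨(1, 1), .up, true⟩,
    ⟨(1, 3), .up, true⟩, ⟨(2, 3), .left, false⟩, ⟨(0, 2), .up, true⟩, ⟨(2, 1), .left, false⟩,
    ⟨(0, 0), .up, true⟩, ⟨(1, 2), .left, false⟩],
   by decide +kernel⟩

theorem exists_checkedRun_turn_low : ∃ l, CheckedRun {(0, 0)}
    (fun c => 1 ≤ c.2 ∨ 1 ≤ c.1 ∧ 0 ≤ c.2)
    l (standardRobot false) ((standardRobot false).image fun c => (c.2, -c.1)) :=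
  ⟨[⟨(-1, 2), .left, true⟩, ⟨(-2, 1), .left, true⟩, ⟨(-2, 2), .down, true⟩,
    ⟨(-2, 2), .left, true⟩, ⟨(-1, 3), .left, true⟩, ⟨(-1, 3), .up, true⟩,
    ⟨(0, 3), .left, true⟩, ⟨(-1, 2), .left, true⟩, ⟨(0, 1), .up, true⟩, ⟨(0, 3), .up, true⟩,
    ⟨(1, 3), .left, false⟩, ⟨(-1, 3), .down, false⟩, ⟨(0, 3), .left, true⟩,
    ⟨(0, 1), .left, true⟩, ⟨(1, 2), .up, true⟩, ⟨(0, 3), .up, true⟩, ⟨(1, 3), .left, true⟩,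
    ⟨(1, 3), .up, true⟩, ⟨(2, 2), .up, true⟩, ⟨(2, 2), .right, true⟩, ⟨(2, 1), .left, false⟩,
    ⟨(0, 0), .up, true⟩, ⟨(1, 2), .left, false⟩],
   by decide +kernel⟩

/-! ### Connected orthogonal convex sets of cells -/

/-- A set of cells that is orthogonal convex and connected, the latter in the form that every
division of the set into two nonempty parts separates two adjacent cells. -/
structure ConvexRegion (A : Set Cell) : Prop where
  column : ∀ x y₁ y₂ y : ℤ, (x, y₁) ∈ A → (x, y₂) ∈ A → y₁ < y → y < y₂ → (x, y) ∈ A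
  row : ∀ y x₁ x₂ x : ℤ, (x₁, y) ∈ A → (x₂, y) ∈ A → x₁ < x → x < x₂ → (x, y) ∈ A
  cross : ∀ X : Set Cell, (∃ a ∈ A, a ∈ X) → (∃ b ∈ A, b ∉ X) →
    ∃ a ∈ A, ∃ b ∈ A, gridGraph.Adj a b ∧ a ∈ X ∧ b ∉ X

theorem convexRegion_coe {S : Finset Cell} (hconn : ConnectedShape S) (hconv : OrthogonalConvex S) :
    ConvexRegion (S : Set Cell) := by
  refine ⟨hconv.1, hconv.2, ?_⟩
  rintro X ⟨a, ha, haX⟩ ⟨b, hb, hbX⟩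
  obtain ⟨p⟩ := hconn.preconnected ⟨a, ha⟩ ⟨b, hb⟩
  obtain ⟨d, -, h1, h2⟩ := p.exists_boundary_dart {c | c.1 ∈ X} haX hbX
  exact ⟨d.fst.1, d.fst.2, d.snd.1, d.snd.2, by simpa using d.adj, h1, h2⟩

/-- A frame may exchange rows with columns and reverse them, hence the four alternatives in each
case. -/
theorem ConvexRegion.preimage_place {A : Set Cell} (hA : ConvexRegion A) (cw : Bool) (f : Side) :
    ConvexRegion (f.place cw ⁻¹' A) := by
  refine ⟨?_, ?_, ?_⟩
  · intro x y₁ y₂ y h1 h2 hy1 hy2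
    obtain ⟨⟨u, v⟩, d⟩ := f
    cases d <;> cases cw <;>
      simp only [Set.mem_preimage, Side.place, Side.travel, Dir.vec, Dir.cw, Dir.ccw, Prod.smul_mk,
        Prod.mk_add_mk, smul_eq_mul, mul_zero, mul_one, add_zero, mul_neg, if_true,
        Bool.false_eq_true, if_false] at h1 h2 ⊢ <;>
      first
      | exact hA.column _ _ _ _ h1 h2 (by omega) (by omega)
      | exact hA.column _ _ _ _ h2 h1 (by omega) (by omega)
      | exact hA.row _ _ _ _ h1 h2 (by omega) (by omega)
      | exact hA.row _ _ _ _ h2 h1 (by omega) (by omega)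
  · intro x y₁ y₂ y h1 h2 hy1 hy2
    obtain ⟨⟨u, v⟩, d⟩ := f
    cases d <;> cases cw <;>
      simp only [Set.mem_preimage, Side.place, Side.travel, Dir.vec, Dir.cw, Dir.ccw, Prod.smul_mk,
        Prod.mk_add_mk, smul_eq_mul, mul_zero, mul_one, add_zero, mul_neg, if_true,
        Bool.false_eq_true, if_false] at h1 h2 ⊢ <;>
      first
      | exact hA.column _ _ _ _ h1 h2 (by omega) (by omega)
      | exact hA.column _ _ _ _ h2 h1 (by omega) (by omega)
      | exact hA.row _ _ _ _ h1 h2 (by omega) (by omega)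
      | exact hA.row _ _ _ _ h2 h1 (by omega) (by omega)
  · rintro X ⟨a, ha, haX⟩ ⟨b, hb, hbX⟩
    have hinj := f.place_injective cw
    obtain ⟨a', ha', b', hb', hadj, haX', hbX'⟩ := hA.cross (f.place cw '' X)
      ⟨_, ha, a, haX, rfl⟩ ⟨_, hb, by rwa [hinj.mem_set_image]⟩
    obtain ⟨a', rfl⟩ := f.place_surjective cw a'
    obtain ⟨b', rfl⟩ := f.place_surjective cw b'
    rw [hinj.mem_set_image] at haX' hbX'
    exact ⟨a', ha', b', hb', (f.adj_place_iff cw _ _).1 hadj, haX', hbX'⟩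

theorem adj_cases {a b : Cell} (h : gridGraph.Adj a b) :
    b = (a.1 + 1, a.2) ∨ b = (a.1 - 1, a.2) ∨ b = (a.1, a.2 + 1) ∨ b = (a.1, a.2 - 1) := by
  obtain ⟨a₁, a₂⟩ := a
  obtain ⟨b₁, b₂⟩ := b
  simp only [gridGraph, abs_eq_max_neg] at h
  simp only [Prod.mk.injEq]
  omega

namespace ConvexRegion

variable {A : Set Cell} (hA : ConvexRegion A)

include hA

theorem notMem_above {x y y' : ℤ} (h : (x, y) ∈ A) (h' : (x, y + 1) ∉ A) (hy : y < y') :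
    (x, y') ∉ A := by
  intro h''
  rcases (show y + 1 ≤ y' by omega).eq_or_lt with h1 | h1
  · exact h' (h1 ▸ h'')
  · exact h' (hA.column _ _ _ _ h h'' (by omega) h1)

theorem notMem_right {x x' y : ℤ} (h : (x, y) ∈ A) (h' : (x + 1, y) ∉ A) (hx : x < x') :
    (x', y) ∉ A := by
  intro h''
  rcases (show x + 1 ≤ x' by omega).eq_or_lt with h1 | h1
  · exact h' (h1 ▸ h'')
  · exact h' (hA.row _ _ _ _ h h'' (by omega) h1)

theorem notMem_left {x x' y : ℤ} (h : (x, y) ∈ A) (h' : (x - 1, y) ∉ A) (hx : x' < x) :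
    (x', y) ∉ A := by
  intro h''
  rcases (show x' ≤ x - 1 by omega).eq_or_lt with h1 | h1
  · exact h' (h1 ▸ h'')
  · exact h' (hA.row _ _ _ _ h'' h h1 (by omega))

/-- If the quadrant above and behind the origin is empty, and the next cell of the row too, then so
is the quadrant ahead. -/
theorem notMem_ahead (h0 : (0, 0) ∈ A) (hq : ∀ x y : ℤ, x ≤ 0 → 1 ≤ y → (x, y) ∉ A)
    (h1 : ((1, 0) : Cell) ∉ A) {x y : ℤ} (hx : 1 ≤ x) (hy : 0 ≤ y) : (x, y) ∉ A := by
  intro hxy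
  have hrow : ∀ x : ℤ, 0 < x → (x, (0 : ℤ)) ∉ A := fun x hx => hA.notMem_right h0 (by simpa) hx
  -- A connection leaving the quadrant ahead passes through its bottom row, empty by `hrow`, or
  -- crosses leftwards into the cells emptied by `hq`.
  obtain ⟨⟨a, b⟩, ha, ⟨a', b'⟩, hb, hadj, haX, hbX⟩ :=
    hA.cross {c | 1 ≤ c.1 ∧ 0 ≤ c.2} ⟨_, hxy, hx, hy⟩ ⟨_, h0, by simp⟩
  simp only [Set.mem_ofPred_eq] at haX hbX
  rcases eq_or_ne b 0 with rfl | hb0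
  · exact hrow a (by omega) ha
  have := adj_cases hadj
  simp only [Prod.mk.injEq] at this
  obtain rfl : b = b' := by omega
  exact hq a' b (by omega) (by omega) hb

/-- If the cell above the origin is empty, then so is the quadrant above and behind the origin or
the one above and ahead of it. -/
theorem empty_behind_or_ahead (h0 : (0, 0) ∈ A) (h1 : ((0, 1) : Cell) ∉ A) :
    (∀ x y : ℤ, x ≤ 0 → 1 ≤ y → (x, y) ∉ A) ∨ (∀ x y : ℤ, 0 ≤ x → 1 ≤ y → (x, y) ∉ A) := by
  by_contra! h
  obtain ⟨⟨x, y, hx, hy, hxy⟩, x', y', hx', hy', hxy'⟩ := h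
  have hcol : ∀ y : ℤ, 1 ≤ y → ((0 : ℤ), y) ∉ A := fun y hy => hA.notMem_above h0 (by simpa) hy
  -- The column over the origin is empty, so the quadrant can only be left downwards, through row 1.
  -- A node of that row on each side of `(0, 1)` contradicts row convexity.
  have hbehind : ∃ a : ℤ, a ≤ -1 ∧ (a, (1 : ℤ)) ∈ A := by
    obtain ⟨⟨a, b⟩, ha, ⟨a', b'⟩, hb, hadj, haX, hbX⟩ :=
      hA.cross {c | c.1 ≤ 0 ∧ 1 ≤ c.2} ⟨_, hxy, hx, hy⟩ ⟨_, h0, by simp⟩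
    simp only [Set.mem_ofPred_eq] at haX hbX
    rcases eq_or_ne a 0 with rfl | ha0
    · exact absurd ha (hcol b haX.2)
    have := adj_cases hadj
    simp only [Prod.mk.injEq] at this
    obtain rfl : b = 1 := by omega
    exact ⟨a, by omega, ha⟩
  have hahead : ∃ a : ℤ, 1 ≤ a ∧ (a, (1 : ℤ)) ∈ A := by
    obtain ⟨⟨a, b⟩, ha, ⟨a', b'⟩, hb, hadj, haX, hbX⟩ :=
      hA.cross {c | 0 ≤ c.1 ∧ 1 ≤ c.2} ⟨_, hxy', hx', hy'⟩ ⟨_, h0, by simp⟩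
    simp only [Set.mem_ofPred_eq] at haX hbX
    rcases eq_or_ne a 0 with rfl | ha0
    · exact absurd ha (hcol b haX.2)
    have := adj_cases hadj
    simp only [Prod.mk.injEq] at this
    obtain rfl : b = 1 := by omega
    exact ⟨a, by omega, ha⟩
  obtain ⟨a, ha, haA⟩ := hbehind
  obtain ⟨a', ha', haA'⟩ := hahead
  exact h1 (hA.row _ _ _ _ haA haA' (by omega) (by omega))

/-- From an empty cell one can leave along a ray of empty cells. -/
theorem exists_ray {x y : ℤ} (h : (x, y) ∉ A) :
    (∀ n : ℕ, (x + n, y) ∉ A) ∨ (∀ n : ℕ, (x - n, y) ∉ A) := by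
  by_contra! hn
  obtain ⟨⟨n, hn⟩, m, hm⟩ := hn
  have h1 : n ≠ 0 := by rintro rfl; exact h (by simpa using hn)
  have h2 : m ≠ 0 := by rintro rfl; exact h (by simpa using hm)
  exact h (hA.row _ _ _ _ hm hn (by omega) (by omega))

end ConvexRegion

/-! ### Perimeter sides, stations and their successors -/

namespace Side

variable (cw : Bool) (e : Side)

theorem place_not_shift (p c : Cell) :
    (Side.mk (e.place cw p) e.dir).place (!cw) c = e.place cw (p + (-c.1, c.2)) := by
  obtain ⟨⟨x, y⟩, d⟩ := e
  cases d <;> cases cw <;>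
    simp [place, travel, Dir.vec, Dir.cw, Dir.ccw] <;> ring_nf <;> trivial

theorem place_not_turn (p c : Cell) :
    (Side.mk (e.place cw p) (e.travel cw)).place (!cw) c = e.place cw (p + (c.2, c.1)) := by
  obtain ⟨⟨x, y⟩, d⟩ := e
  cases d <;> cases cw <;>
    simp [place, travel, Dir.vec, Dir.cw, Dir.ccw] <;> ring_nf <;> trivial

theorem place_not_turn_opp (p c : Cell) :
    (Side.mk (e.place cw p) (e.travel cw).opp).place (!cw) c =
      e.place cw (p + (-c.2, -c.1)) := by
  obtain ⟨⟨x, y⟩, d⟩ := e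
  cases d <;> cases cw <;>
    simp [place, travel, Dir.vec, Dir.cw, Dir.ccw, Dir.opp] <;> ring_nf <;> trivial

theorem eq_wall_of_floor :
    e = ⟨(e.floor cw).place cw (1, 1), ((e.floor cw).travel cw).opp⟩ := by
  rw [place_floor]
  simp only [sub_self, place_zero]
  obtain ⟨b, d⟩ := e
  cases d <;> cases cw <;> rfl

theorem floor_wall : (Side.mk (e.place cw (1, 1)) (e.travel cw).opp).floor cw = e := by
  rw [floor, place_turn_opp, travel_turn_opp]
  simp [place_zero]

theorem floor_shift : (Side.mk (e.place cw (1, 0)) e.dir).floor cw =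
    ⟨(e.floor cw).place cw (0, 1), (e.floor cw).dir⟩ := by
  rw [place_floor, floor, place_shift]
  rfl

end Side

section Next

variable {S : Finset Cell} {cw : Bool} {e : Side}

theorem nextSide_of_mem (h : e.place cw (1, 1) ∈ S) :
    nextSide S cw e = ⟨e.place cw (1, 1), (e.travel cw).opp⟩ := by
  have : e.place cw (1, 1) = e.base + e.dir.vec + (e.travel cw).vec := by
    simp [Side.place, add_right_comm]
  rw [this] at h ⊢
  exact if_pos h

theorem nextSide_of_notMem_of_mem (h : e.place cw (1, 1) ∉ S) (h' : e.place cw (1, 0) ∈ S) :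
    nextSide S cw e = ⟨e.place cw (1, 0), e.dir⟩ := by
  have h1 : e.place cw (1, 1) = e.base + e.dir.vec + (e.travel cw).vec := by
    simp [Side.place, add_right_comm]
  have h2 : e.place cw (1, 0) = e.base + (e.travel cw).vec := by
    simp [Side.place]
  rw [h1] at h
  rw [h2] at h' ⊢
  exact (if_neg h).trans (if_pos h')

theorem nextSide_of_notMem_of_notMem (h : e.place cw (1, 1) ∉ S) (h' : e.place cw (1, 0) ∉ S) :
    nextSide S cw e = ⟨e.place cw (0, 0), e.travel cw⟩ := by
  have h1 : e.place cw (1, 1) = e.base + e.dir.vec + (e.travel cw).vec := by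
    simp [Side.place, add_right_comm]
  have h2 : e.place cw (1, 0) = e.base + (e.travel cw).vec := by
    simp [Side.place]
  rw [h1] at h
  rw [h2] at h'
  rw [Side.place_zero]
  exact (if_neg h).trans (if_neg h')

variable (hA : ConvexRegion (S : Set Cell))

include hA

/-- There are no holes: by row convexity an empty cell escapes along a horizontal ray. -/
theorem isPerimeterSide_iff :
    IsPerimeterSide S e ↔ e.place cw (0, 0) ∈ S ∧ e.place cw (0, 1) ∉ S := by
  rw [Side.place_zero, Side.place_outer, IsPerimeterSide]
  refine and_congr_right fun _ => not_congr ⟨fun h => ?_, fun h p hp _ _ => ⟨0, hp ▸ h⟩⟩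
  by_contra hout
  rcases hA.exists_ray (x := e.outer.1) (y := e.outer.2) hout with hray | hray
  · obtain ⟨i, hi⟩ := h (fun n => (e.outer.1 + n, e.outer.2)) (by simp)
      (fun a b hab => by simpa using hab) (fun i => by simp [gridGraph])
    exact hray i hi
  · obtain ⟨i, hi⟩ := h (fun n => (e.outer.1 - n, e.outer.2)) (by simp)
      (fun a b hab => by simpa using hab) (fun i => by simp [gridGraph])
    exact hray i hi

omit hA in
theorem isStation_iff : IsStation S cw e ↔
    IsPerimeterSide S e ∧ ∀ x y : ℤ, x ≤ 0 → 1 ≤ y → e.place cw (x, y) ∉ S := by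
  refine and_congr_right fun _ => ⟨fun h x y hx hy => ?_, fun h i j => ?_⟩
  · convert h (y - 1).toNat (-x).toNat using 2
    have h1 : ((((y - 1).toNat + 1 : ℕ)) : ℤ) = y := by omega
    have h2 : (((-x).toNat : ℕ) : ℤ) = -x := by omega
    rw [← natCast_zsmul, ← natCast_zsmul, h1, h2, Side.place, neg_smul]
    simp only
    abel
  · convert h (-j) (i + 1) (by omega) (by omega) using 2
    rw [← natCast_zsmul, ← natCast_zsmul, Side.place, neg_smul]
    simp only [Nat.cast_add, Nat.cast_one]
    abel

theorem IsPerimeterSide.nextSide (he : IsPerimeterSide S e) :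
    IsPerimeterSide S (nextSide S cw e) := by
  have h := (isPerimeterSide_iff (cw := cw) hA).1 he
  by_cases h1 : e.place cw (1, 1) ∈ S
  · rw [nextSide_of_mem h1, isPerimeterSide_iff (cw := cw) hA, Side.place_turn_opp,
      Side.place_turn_opp]
    exact ⟨h1, h.2⟩
  by_cases h2 : e.place cw (1, 0) ∈ S
  · rw [nextSide_of_notMem_of_mem h1 h2, isPerimeterSide_iff (cw := cw) hA, Side.place_shift,
      Side.place_shift]
    exact ⟨h2, h1⟩
  · rw [nextSide_of_notMem_of_notMem h1 h2, isPerimeterSide_iff (cw := cw) hA, Side.place_turn,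
      Side.place_turn]
    exact ⟨h.1, h2⟩

/-- Going back in the other sense inverts the passage to the next side. -/
theorem nextSide_not_nextSide (he : IsPerimeterSide S e) :
    nextSide S (!cw) (nextSide S cw e) = e := by
  have h := (isPerimeterSide_iff (cw := cw) hA).1 he
  by_cases h1 : e.place cw (1, 1) ∈ S
  · rw [nextSide_of_mem h1, nextSide_of_mem (by rw [Side.place_not_turn_opp]; exact h.1),
      Side.place_not_turn_opp]
    simp only [Prod.mk_add_mk, add_neg_cancel, Side.place_zero]
    obtain ⟨b, d⟩ := e
    cases d <;> cases cw <;> rfl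
  by_cases h2 : e.place cw (1, 0) ∈ S
  · rw [nextSide_of_notMem_of_mem h1 h2, nextSide_of_notMem_of_mem
      (by rw [Side.place_not_shift]; exact h.2) (by rw [Side.place_not_shift]; exact h.1),
      Side.place_not_shift]
    simp [Side.place_zero]
  · rw [nextSide_of_notMem_of_notMem h1 h2, nextSide_of_notMem_of_notMem
      (by rw [Side.place_not_turn]; exact h1) (by rw [Side.place_not_turn]; exact h.2),
      Side.place_not_turn]
    simp only [Prod.mk_add_mk, add_zero, Side.place_zero]
    obtain ⟨b, d⟩ := e
    cases d <;> cases cw <;> rfl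

/-- At a concave corner a station is followed by the lowest side of a wall. -/
theorem IsStation.not_isStation_wall (he : IsStation S cw e) :
    ¬ IsStation S cw ⟨e.place cw (1, 1), (e.travel cw).opp⟩ := by
  rw [isStation_iff]
  intro h
  have := h.2 (-1) 1 (by omega) le_rfl
  rw [Side.place_turn_opp] at this
  exact this ((isPerimeterSide_iff (cw := cw) hA).1 he.1).1

/-- The quadrant gains a single column, empty because its lowest cell is empty over a node. -/
theorem IsStation.shift (he : IsStation S cw e) (h1 : e.place cw (1, 1) ∉ S)
    (h2 : e.place cw (1, 0) ∈ S) : IsStation S cw ⟨e.place cw (1, 0), e.dir⟩ := by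
  rw [isStation_iff] at he ⊢
  refine ⟨?_, fun x y hx hy => ?_⟩
  · rw [isPerimeterSide_iff (cw := cw) hA, Side.place_shift, Side.place_shift]
    exact ⟨h2, h1⟩
  · rw [Side.place_shift]
    rcases hx.eq_or_lt with rfl | hx
    · exact (hA.preimage_place cw e).notMem_above (x := 1) (y := 0) h2 h1 (by omega)
    · simpa using he.2 (1 + x) y (by omega) hy

theorem IsStation.notMem_ahead (he : IsStation S cw e) (h2 : e.place cw (1, 0) ∉ S) {x y : ℤ}
    (hx : 1 ≤ x) (hy : 0 ≤ y) : e.place cw (x, y) ∉ S :=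
  (hA.preimage_place cw e).notMem_ahead ((isPerimeterSide_iff (cw := cw) hA).1 he.1).1
    (isStation_iff.1 he).2 h2 hx hy

/-- The quadrant ahead of the old side is the quadrant behind the new one. -/
theorem isStation_turn (he : IsPerimeterSide S e)
    (h : ∀ x y : ℤ, 1 ≤ x → 0 ≤ y → e.place cw (x, y) ∉ S) :
    IsStation S cw ⟨e.place cw (0, 0), e.travel cw⟩ := by
  rw [isStation_iff, isPerimeterSide_iff (cw := cw) hA]
  simp only [Side.place_turn]
  refine ⟨⟨((isPerimeterSide_iff (cw := cw) hA).1 he).1, h 1 0 le_rfl le_rfl⟩, fun x y hx hy => ?_⟩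
  simpa using h y (-x) hy (by omega)

theorem notMem_ahead_of_not_isStation (he : IsPerimeterSide S e) (hs : ¬ IsStation S cw e)
    {x y : ℤ} (hx : 0 ≤ x) (hy : 1 ≤ y) : e.place cw (x, y) ∉ S := by
  have h := (isPerimeterSide_iff (cw := cw) hA).1 he
  rcases (hA.preimage_place cw e).empty_behind_or_ahead h.1 h.2 with h' | h'
  · exact absurd (isStation_iff.2 ⟨he, h'⟩) hs
  · exact h' x y hx hy

omit hA in
theorem not_isStation_shift (he : IsPerimeterSide S e) (hs : ¬ IsStation S cw e) :
    ¬ IsStation S cw ⟨e.place cw (1, 0), e.dir⟩ := by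
  rw [isStation_iff] at hs ⊢
  refine fun h => hs ⟨he, fun x y hx hy => ?_⟩
  have := h.2 (x - 1) y (by omega) hy
  rw [Side.place_shift] at this
  simpa using this

theorem isStation_top (he : IsPerimeterSide S e) (hs : ¬ IsStation S cw e)
    (h2 : e.place cw (1, 0) ∉ S) : IsStation S cw ⟨e.place cw (0, 0), e.travel cw⟩ := by
  refine isStation_turn hA he fun x y hx hy => ?_
  rcases hy.eq_or_lt with rfl | hy
  · exact (hA.preimage_place cw e).notMem_right (x := 0)
      ((isPerimeterSide_iff (cw := cw) hA).1 he).1 h2 hx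
  · exact notMem_ahead_of_not_isStation hA he hs (by omega) hy

/-! ### The perimeter is a single cycle -/

omit hA in
theorem finite_isPerimeterSide (S : Finset Cell) : Finite {e // IsPerimeterSide S e} := by
  let φ : {e // IsPerimeterSide S e} → S × Fin 4 := fun e =>
    (⟨e.1.base, e.2.1⟩, match e.1.dir with | .up => 0 | .right => 1 | .down => 2 | .left => 3)
  refine Finite.of_injective φ ?_
  rintro ⟨⟨b, d⟩, h⟩ ⟨⟨b', d'⟩, h'⟩ heq
  cases d <;> cases d' <;> simp_all [φ]

theorem IsPerimeterSide.iterate_nextSide (he : IsPerimeterSide S e) (n : ℕ) :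
    IsPerimeterSide S ((_root_.nextSide S cw)^[n] e) := by
  induction n with
  | zero => exact he
  | succ n ih => rw [Function.iterate_succ_apply']; exact ih.nextSide hA

/-- An injective self-map of a finite set has only periodic points; injectivity comes from the
reverse sense. -/
theorem IsPerimeterSide.mem_periodicPts (he : IsPerimeterSide S e) :
    e ∈ Function.periodicPts (_root_.nextSide S cw) := by
  have := finite_isPerimeterSide S
  let g : {e // IsPerimeterSide S e} → {e // IsPerimeterSide S e} :=
    fun e => ⟨_root_.nextSide S cw e.1, e.2.nextSide hA⟩
  have hg : Function.Injective g := by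
    rintro ⟨a, ha⟩ ⟨b, hb⟩ hab
    have := congrArg (fun c => _root_.nextSide S (!cw) c.1) hab
    simpa [g, nextSide_not_nextSide hA ha, nextSide_not_nextSide hA hb] using this
  obtain ⟨n, hn, hper⟩ := hg.mem_periodicPts ⟨e, he⟩
  refine ⟨n, hn, ?_⟩
  have hsemi : ∀ (n : ℕ) (x : {e // IsPerimeterSide S e}),
      (g^[n] x).1 = (_root_.nextSide S cw)^[n] x.1 := fun n x =>
    (Function.Semiconj.iterate_right (f := Subtype.val) (ga := g) (gb := _root_.nextSide S cw)
      (fun _ => rfl) n) x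
  have := congrArg Subtype.val hper
  rwa [hsemi] at this

/-- A station at which the perimeter turns around a convex corner. -/
def IsTurningStation (S : Finset Cell) (cw : Bool) (e : Side) : Prop :=
  IsStation S cw e ∧ e.place cw (1, 1) ∉ S ∧ e.place cw (1, 0) ∉ S

/-- The sides that are met on the way up from the side `f`, with coordinates in the frame of `f`. -/
def OnAscent (S : Finset Cell) (cw : Bool) (f : Side) (n : ℤ) (e : Side) : Prop :=
  ∃ c : Cell,
    (e = ⟨f.place cw c, f.dir⟩ ∧ IsStation S cw e ∧ n = 2 * (c.1 + c.2) + 1) ∨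
    (e = ⟨f.place cw c, (f.travel cw).opp⟩ ∧ IsPerimeterSide S e ∧ ¬ IsStation S cw e ∧
      n = 2 * (c.1 + c.2))

omit hA in
theorem OnAscent.unique {f : Side} {m n : ℤ} (hm : OnAscent S cw f m e) (hn : OnAscent S cw f n e) :
    m = n := by
  obtain ⟨c, ⟨h1, h2, h3⟩ | ⟨h1, -, h2, h3⟩⟩ := hm <;>
  obtain ⟨c', ⟨h1', h2', h3'⟩ | ⟨h1', -, h2', h3'⟩⟩ := hn
  · obtain rfl := f.place_injective cw (congrArg Side.base (h1.symm.trans h1'))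
    rw [h3, h3']
  · exact absurd h2 h2'
  · exact absurd h2' h2
  · obtain rfl := f.place_injective cw (congrArg Side.base (h1.symm.trans h1'))
    rw [h3, h3']

/-- The potential is twice the coordinate sum of the node, plus one at stations: the extra one
records progress at the top of a wall, where the node stays the same. -/
theorem OnAscent.next {f : Side} {n : ℤ} (h : OnAscent S cw f n e)
    (hturn : ¬ (IsTurningStation S cw e ∧ e.dir = f.dir)) :
    ∃ n' > n, OnAscent S cw f n' (nextSide S cw e) := by
  obtain ⟨c, ⟨h1, h2, h3⟩ | ⟨h1, hp, h2, h3⟩⟩ := h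
  · have hplace : ∀ c', e.place cw c' = f.place cw (c + c') := fun c' => by
      rw [h1, Side.place_shift]
    have hdir : e.dir = f.dir := by rw [h1]
    have htravel : e.travel cw = f.travel cw := by rw [h1]; rfl
    by_cases hc : e.place cw (1, 1) ∈ S
    · have hnext := h2.1.nextSide (cw := cw) hA
      rw [nextSide_of_mem hc] at hnext ⊢
      refine ⟨n + 3, by omega, c + (1, 1), .inr ⟨by rw [hplace, htravel], hnext,
        h2.not_isStation_wall hA, ?_⟩⟩
      simp only [Prod.fst_add, Prod.snd_add]
      omega
    by_cases hc' : e.place cw (1, 0) ∈ S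
    · rw [nextSide_of_notMem_of_mem hc hc']
      refine ⟨n + 2, by omega, c + (1, 0), .inl ⟨by rw [hplace, hdir], h2.shift hA hc hc', ?_⟩⟩
      simp only [Prod.fst_add, Prod.snd_add]
      omega
    · exact absurd ⟨⟨h2, hc, hc'⟩, hdir⟩ hturn
  · have htravel : e.travel cw = f.dir := by rw [h1, Side.travel_turn_opp]
    have hdir : e.dir = (f.travel cw).opp := by rw [h1]
    have hplace : ∀ c', e.place cw c' = f.place cw (c + (-c'.2, c'.1)) := fun c' => by
      rw [h1, Side.place_turn_opp]
    have hc := notMem_ahead_of_not_isStation hA hp h2 (x := 1) (y := 1) (by simp) le_rfl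
    by_cases hc' : e.place cw (1, 0) ∈ S
    · have hnext := hp.nextSide (cw := cw) hA
      rw [nextSide_of_notMem_of_mem hc hc'] at hnext ⊢
      refine ⟨n + 2, by omega, c + (0, 1), .inr ⟨by rw [hplace, hdir]; rfl, hnext,
        not_isStation_shift hp h2, ?_⟩⟩
      simp only [Prod.fst_add, Prod.snd_add]
      omega
    · rw [nextSide_of_notMem_of_notMem hc hc']
      refine ⟨n + 1, by omega, c, .inl ⟨?_, isStation_top hA hp h2 hc', by omega⟩⟩
      rw [hplace, htravel]
      exact congrArg (fun c => Side.mk (f.place cw c) f.dir) (add_zero c)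

omit hA in
theorem IsStation.onAscent (he : IsStation S cw e) : OnAscent S cw e 1 e :=
  ⟨(0, 0), .inl ⟨by rw [Side.place_zero], he, rfl⟩⟩

/-- An endless ascent would return to `e` by periodicity with a larger potential, against
`OnAscent.unique`. -/
theorem OnAscent.exists_turning {f : Side} {n : ℤ} (h : OnAscent S cw f n e) :
    ∃ k, IsTurningStation S cw ((nextSide S cw)^[k] e) ∧ ((nextSide S cw)^[k] e).dir = f.dir := by
  by_contra! hne
  have key : ∀ k : ℕ, ∃ n' ≥ n + k, OnAscent S cw f n' ((nextSide S cw)^[k] e) := by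
    intro k
    induction k with
    | zero => exact ⟨n, by simp, h⟩
    | succ k ih =>
      obtain ⟨n', hn', ih⟩ := ih
      obtain ⟨n'', hn'', ih'⟩ := ih.next hA fun h => hne k h.1 h.2
      exact ⟨n'', by push_cast; omega, by rwa [Function.iterate_succ_apply']⟩
  have he : IsPerimeterSide S e := by
    obtain ⟨c, ⟨-, h2, -⟩ | ⟨-, hp, -⟩⟩ := h
    exacts [h2.1, hp]
  obtain ⟨p, hp, hper⟩ := he.mem_periodicPts (cw := cw) hA
  obtain ⟨n', hn', h'⟩ := key p
  rw [hper] at h'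
  have := h.unique h'
  omega

theorem IsPerimeterSide.exists_turning (he : IsPerimeterSide S e) :
    ∃ k, IsTurningStation S cw ((_root_.nextSide S cw)^[k] e) := by
  by_cases hs : IsStation S cw e
  · obtain ⟨k, hk, -⟩ := hs.onAscent.exists_turning hA
    exact ⟨k, hk⟩
  · obtain ⟨k, hk, -⟩ := OnAscent.exists_turning hA
      (⟨(1, 1), .inr ⟨e.eq_wall_of_floor cw, he, hs, rfl⟩⟩ : OnAscent S cw (e.floor cw) _ e)
    exact ⟨k, hk⟩

theorem IsTurningStation.exists_turning (he : IsTurningStation S cw e) :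
    ∃ k, IsTurningStation S cw ((nextSide S cw)^[k] e) ∧
      ((nextSide S cw)^[k] e).dir = e.travel cw := by
  have hs := isStation_turn hA he.1.1 fun x y hx hy => he.1.notMem_ahead hA he.2.2 hx hy
  obtain ⟨k, hk⟩ := hs.onAscent.exists_turning hA
  refine ⟨k + 1, ?_⟩
  rwa [Function.iterate_succ_apply, nextSide_of_notMem_of_notMem he.2.1 he.2.2]

theorem IsPerimeterSide.exists_turning_up (he : IsPerimeterSide S e) :
    ∃ k, IsTurningStation S cw ((_root_.nextSide S cw)^[k] e) ∧
      ((_root_.nextSide S cw)^[k] e).dir = .up := by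
  have key : ∀ n k, IsTurningStation S cw ((_root_.nextSide S cw)^[k] e) →
      (fun d : Dir => if cw then d.cw else d.ccw)^[n] ((_root_.nextSide S cw)^[k] e).dir = .up →
      ∃ k, IsTurningStation S cw ((_root_.nextSide S cw)^[k] e) ∧
        ((_root_.nextSide S cw)^[k] e).dir = .up := by
    intro n
    induction n with
    | zero => exact fun k hk hd => ⟨k, hk, hd⟩
    | succ n ih =>
      intro k hk hd
      obtain ⟨j, hj, hjd⟩ := hk.exists_turning hA
      rw [← Function.iterate_add_apply] at hj hjd
      exact ih _ hj (by rwa [hjd])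
  obtain ⟨k, hk⟩ := he.exists_turning (cw := cw) hA
  have hd : ∃ n, (fun d : Dir => if cw then d.cw else d.ccw)^[n]
      ((_root_.nextSide S cw)^[k] e).dir = .up := by
    generalize ((_root_.nextSide S cw)^[k] e).dir = d
    cases cw <;> cases d
    exacts [⟨0, rfl⟩, ⟨1, rfl⟩, ⟨2, rfl⟩, ⟨3, rfl⟩, ⟨0, rfl⟩, ⟨3, rfl⟩, ⟨2, rfl⟩, ⟨1, rfl⟩]
  obtain ⟨n, hn⟩ := hd
  exact key n k hk hn

/-- Seen from a turning station, its node is the last one of the outermost row, which determines it.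
-/
theorem IsTurningStation.eq_of_dir_eq {f : Side} (he : IsTurningStation S cw e)
    (hf : IsTurningStation S cw f) (hd : f.dir = e.dir) : f = e := by
  have key : ∀ {e : Side}, IsTurningStation S cw e → ∀ x y : ℤ, e.place cw (x, y) ∈ S →
      y < 0 ∨ y = 0 ∧ x ≤ 0 := by
    intro e he x y h
    by_contra! hlt
    rcases le_or_gt 1 x with hx | hx
    · exact he.1.notMem_ahead hA he.2.2 hx hlt.1 h
    · exact (isStation_iff.1 he.1).2 x y (by omega) (by omega) h
  obtain ⟨⟨x, y⟩, hc⟩ := e.place_surjective cw f.base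
  have hfe : f = ⟨e.place cw (x, y), e.dir⟩ := by rw [hc, ← hd]
  have h1 := key he x y (by rw [hc]; exact hf.1.1.1)
  have h2 := key hf (-x) (-y) (by
    rw [hfe, Side.place_shift]
    simpa [Side.place_zero] using he.1.1.1)
  obtain rfl : x = 0 := by omega
  obtain rfl : y = 0 := by omega
  rw [hfe, Side.place_zero]

/-- Every perimeter side is reached from every other one. -/
theorem IsPerimeterSide.exists_iterate_eq {f : Side} (he : IsPerimeterSide S e)
    (hf : IsPerimeterSide S f) : ∃ n, (_root_.nextSide S cw)^[n] e = f := by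
  obtain ⟨a, ha, hau⟩ := he.exists_turning_up (cw := cw) hA
  obtain ⟨b, hb, hbu⟩ := hf.exists_turning_up (cw := cw) hA
  have hab := ha.eq_of_dir_eq hA hb (hbu.trans hau.symm)
  obtain ⟨q, hq, hper⟩ := hf.mem_periodicPts (cw := cw) hA
  -- After `a` steps `e` reaches the corner lying `b` steps after `f`; the other steps complete `q *
  -- b`, a multiple of the period of `f`.
  refine ⟨q * b - b + a, ?_⟩
  rw [Function.iterate_add_apply, ← hab, ← Function.iterate_add_apply,
    Nat.sub_add_cancel (Nat.le_mul_of_pos_left b hq)]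
  exact (hper.mul_const b).eq

theorem exists_isStation (hne : S.Nonempty) : ∃ e, IsStation S cw e := by
  obtain ⟨u, hu, hmax⟩ := S.exists_max_image Prod.snd hne
  have h : ∀ c : Cell, 1 ≤ c.2 → (Side.mk u .up).place cw c ∉ S := by
    intro c hc hcS
    have := hmax _ hcS
    cases cw <;> simp [Side.place, Side.travel, Dir.vec, Dir.cw, Dir.ccw] at this <;> omega
  refine ⟨⟨u, .up⟩, isStation_iff.2 ⟨(isPerimeterSide_iff (cw := cw) hA).2 ⟨?_, h _ le_rfl⟩,
    fun x y _ hy => h _ hy⟩⟩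
  rwa [Side.place_zero]

end Next

/-! ### The robot on a side -/

section Step

variable {S : Finset Cell} {cw : Bool} {e : Side}

/-- The robot is ready on the side `e`: in formation on `e` if `e` is a station, and in the
formation of the floor, lifted to the height of `e`, if `e` belongs to a wall. -/
def Ready (S : Finset Cell) (cw : Bool) (e : Side) (R : Finset Cell) : Prop :=
  (IsStation S cw e ∧ ∃ high, R = sevenRobot cw e high) ∨
    (¬ IsStation S cw e ∧ ∃ high, R = sevenRobot cw (e.floor cw) high)

theorem mem_standardRobot (high : Bool) : ((0, 1) : Cell) ∈ standardRobot high := by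
  simp [standardRobot]

theorem Ready.outer_mem {R : Finset Cell} (h : Ready S cw e R) : e.outer ∈ R := by
  rcases h with ⟨-, high, rfl⟩ | ⟨-, high, rfl⟩ <;>
    rw [sevenRobot_eq_image, Finset.mem_image] <;>
    refine ⟨(0, 1), mem_standardRobot high, ?_⟩
  · exact e.place_outer cw
  · rw [Side.place_floor, ← e.place_outer cw]
    rfl

theorem sevenRobot_shift (f : Side) (p : Cell) (high : Bool) :
    sevenRobot cw ⟨f.place cw p, f.dir⟩ high =
      ((standardRobot high).image (p + ·)).image (f.place cw) := by
  rw [sevenRobot_eq_image, Finset.image_image]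
  exact Finset.image_congr fun c _ => f.place_shift cw p c

theorem sevenRobot_turn (f : Side) (high : Bool) :
    sevenRobot cw ⟨f.place cw (0, 0), f.travel cw⟩ high =
      ((standardRobot high).image fun c => (c.2, -c.1)).image (f.place cw) := by
  rw [sevenRobot_eq_image, Finset.image_image]
  refine Finset.image_congr fun c _ => ?_
  rw [f.place_turn cw]
  simp

variable (hconn : ConnectedShape S) (hA : ConvexRegion (S : Set Cell))

include hconn hA

theorem IsStation.robotPath_shift (he : IsStation S cw e) (h1 : e.place cw (1, 1) ∉ S)
    (h2 : e.place cw (1, 0) ∈ S) (high : Bool) :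
    RobotPath S (Sound S e) (sevenRobot cw e high)
      (sevenRobot cw ⟨e.place cw (1, 0), e.dir⟩ (!high)) := by
  have h0 := ((isPerimeterSide_iff (cw := cw) hA).1 he.1).1
  have hfree : ∀ c : Cell, c.1 ≤ 1 → 1 ≤ c.2 → e.place cw c ∉ S := by
    intro c hc1 hc2
    have := (isStation_iff.1 (he.shift hA h1 h2)).2 (c.1 - 1) c.2 (by omega) hc2
    rw [Side.place_shift] at this
    simpa using this
  rw [sevenRobot_eq_image cw e, sevenRobot_shift]
  cases high
  · obtain ⟨l, hl⟩ := exists_checkedRun_step_low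
    refine hl.robotPath cw e hconn ?_ (fun c hc => hfree c hc.1 hc.2)
      fun c hc => (e.notBelow_place cw c).2 (by omega)
    simp [h0, h2]
  -- If the cell behind is empty, row convexity empties the whole row behind it.
  · by_cases hback : e.place cw (-1, 0) ∈ S
    · obtain ⟨l, hl⟩ := exists_checkedRun_step_high_of_floor
      refine hl.robotPath cw e hconn ?_ (fun c hc => hfree c hc.1 hc.2)
        fun c hc => (e.notBelow_place cw c).2 (by omega)
      simp [h0, h2, hback]
    · obtain ⟨l, hl⟩ := exists_checkedRun_step_high_of_free
      refine hl.robotPath cw e hconn ?_ ?_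
        fun c hc => (e.notBelow_place cw c).2 (by omega)
      · simp [h0, h2]
      · rintro ⟨x, y⟩ (hc | hc)
        · exact hfree _ hc.1 hc.2
        · rcases hc.2.eq_or_lt with rfl | hy
          · exact (hA.preimage_place cw e).notMem_left (x := 0) h0 hback
              (by have := hc.1; simp only at this; omega)
          · exact hfree _ (by have := hc.1; simp only at this ⊢; omega) hy

theorem IsStation.robotPath_turn (he : IsStation S cw e) (h2 : e.place cw (1, 0) ∉ S)
    (high : Bool) :
    RobotPath S (Sound S e) (sevenRobot cw e high)
      (sevenRobot cw ⟨e.place cw (0, 0), e.travel cw⟩ high) := by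
  have h0 := ((isPerimeterSide_iff (cw := cw) hA).1 he.1).1
  have hfree : ∀ c : Cell, 1 ≤ c.2 ∨ 1 ≤ c.1 ∧ 0 ≤ c.2 → e.place cw c ∉ S := by
    intro c hc
    rcases le_or_gt 1 c.1 with h | h
    · exact he.notMem_ahead hA h2 h (by omega)
    · exact (isStation_iff.1 he).2 c.1 c.2 (by omega) (by omega)
  rw [sevenRobot_eq_image cw e, sevenRobot_turn]
  have hrun : ∃ l, CheckedRun {(0, 0)} (fun c => 1 ≤ c.2 ∨ 1 ≤ c.1 ∧ 0 ≤ c.2) l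
      (standardRobot high) ((standardRobot high).image fun c => (c.2, -c.1)) := by
    cases high
    exacts [exists_checkedRun_turn_low, exists_checkedRun_turn_high]
  obtain ⟨l, hl⟩ := hrun
  exact hl.robotPath cw e hconn (by simpa using h0) hfree
    fun c hc => (e.notBelow_place cw c).2 (by omega)

omit hconn hA in
theorem notBelow_place_floor (c : Cell) :
    NotBelow e ((e.floor cw).place cw c) ↔ c.1 ≤ 1 := by
  rw [Side.place_floor, Side.notBelow_place]
  exact sub_nonneg

omit hconn in
theorem place_floor_notMem (he : IsPerimeterSide S e) (hs : ¬ IsStation S cw e) {c : Cell}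
    (h1 : c.1 ≤ 0) (h2 : 1 ≤ c.2) : (e.floor cw).place cw c ∉ S := by
  rw [Side.place_floor]
  exact notMem_ahead_of_not_isStation hA he hs (by omega) (by omega)

theorem robotPath_climb (he : IsPerimeterSide S e) (hs : ¬ IsStation S cw e)
    (h2 : e.place cw (1, 0) ∈ S) (high : Bool) :
    RobotPath S (Sound S e) (sevenRobot cw (e.floor cw) high)
      (sevenRobot cw ⟨(e.floor cw).place cw (0, 1), (e.floor cw).dir⟩ (!high)) := by
  have h0 : (e.floor cw).place cw (1, 1) ∈ S := by
    rw [Side.place_floor]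
    exact ((isPerimeterSide_iff (cw := cw) hA).1 he).1
  have h0' : (e.floor cw).place cw (1, 2) ∈ S := by
    rw [Side.place_floor]
    exact h2
  have hfree : ∀ c : Cell, c.1 ≤ 0 ∧ 1 ≤ c.2 → (e.floor cw).place cw c ∉ S :=
    fun c hc => place_floor_notMem hA he hs hc.1 hc.2
  rw [sevenRobot_eq_image cw (e.floor cw), sevenRobot_shift]
  cases high
  · by_cases h3 : (e.floor cw).place cw (1, 3) ∈ S
    · obtain ⟨l, hl⟩ := exists_checkedRun_climb_low_of_wall
      exact hl.robotPath cw _ hconn (by simp [h0, h0', h3]) hfree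
        fun c hc => notBelow_place_floor c |>.2 (by omega)
    · obtain ⟨l, hl⟩ := exists_checkedRun_climb_low_of_free
      refine hl.robotPath cw _ hconn (by simp [h0, h0']) ?_
        fun c hc => notBelow_place_floor c |>.2 (by omega)
      rintro ⟨x, y⟩ (hc | ⟨rfl, hy⟩)
      · exact hfree _ hc
      · exact (hA.preimage_place cw (e.floor cw)).notMem_above (x := 1) (y := 2) h0' h3
          (by simp only at hy; omega)
  · obtain ⟨l, hl⟩ := exists_checkedRun_climb_high
    exact hl.robotPath cw _ hconn (by simp [h0, h0']) hfree
      fun c hc => notBelow_place_floor c |>.2 (by omega)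

theorem robotPath_top (he : IsPerimeterSide S e) (hs : ¬ IsStation S cw e)
    (h2 : e.place cw (1, 0) ∉ S) (high : Bool) :
    RobotPath S (Sound S e) (sevenRobot cw (e.floor cw) high)
      (sevenRobot cw ⟨(e.floor cw).place cw (1, 1), (e.floor cw).dir⟩ high) := by
  have h0 : (e.floor cw).place cw (1, 1) ∈ S := by
    rw [Side.place_floor]
    exact ((isPerimeterSide_iff (cw := cw) hA).1 he).1
  have h0' : (e.floor cw).place cw (1, 2) ∉ S := by
    rw [Side.place_floor]
    exact h2
  have hfree : ∀ c : Cell, c.1 ≤ 0 ∧ 1 ≤ c.2 ∨ c.1 = 1 ∧ 2 ≤ c.2 →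
      (e.floor cw).place cw c ∉ S := by
    rintro ⟨x, y⟩ (hc | ⟨rfl, hy⟩)
    · exact place_floor_notMem hA he hs hc.1 hc.2
    · exact (hA.preimage_place cw (e.floor cw)).notMem_above (x := 1) (y := 1) h0 h0'
        (by simp only at hy; omega)
  rw [sevenRobot_eq_image cw (e.floor cw), sevenRobot_shift]
  have hrun : ∃ l, CheckedRun {(1, 1)} (fun c => c.1 ≤ 0 ∧ 1 ≤ c.2 ∨ c.1 = 1 ∧ 2 ≤ c.2) l
      (standardRobot high) ((standardRobot high).image ((1, 1) + ·)) := by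
    cases high
    exacts [exists_checkedRun_top_low, exists_checkedRun_top_high]
  obtain ⟨l, hl⟩ := hrun
  exact hl.robotPath cw _ hconn (by simpa using h0) hfree
    fun c hc => notBelow_place_floor c |>.2 (by omega)

/-- A robot that is ready on a perimeter side is sound. -/
theorem Ready.sound {R : Finset Cell} (he : IsPerimeterSide S e) (h : Ready S cw e R) :
    Sound S e R := by
  -- The lifted formation begins a climb or a top run, so its soundness is that of a path at time 0.
  have hstart : ∀ {R R'}, RobotPath S (Sound S e) R R' → Sound S e R := by
    rintro R R' ⟨n, ρ, h0, -, -, hP⟩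
    exact h0 ▸ hP 0 (Nat.zero_le n)
  rcases h with ⟨hs, high, rfl⟩ | ⟨hs, high, rfl⟩
  · have hanch : Anchored {(0, 0)} (standardRobot high) := by cases high <;> decide +kernel
    have hfree : ∀ c ∈ standardRobot high, c.1 ≤ 0 ∧ 1 ≤ c.2 := by cases high <;> decide +kernel
    rw [sevenRobot_eq_image]
    refine hanch.sound hconn ?_ (fun c hc => (isStation_iff.1 hs).2 c.1 c.2 hc.1 hc.2)
      (fun c hc => (e.notBelow_place cw c).2 (by omega)) hfree
    simpa using ((isPerimeterSide_iff (cw := cw) hA).1 he).1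
  · by_cases h2 : e.place cw (1, 0) ∈ S
    · exact hstart (robotPath_climb hconn hA he hs h2 high)
    · exact hstart (robotPath_top hconn hA he hs h2 high)

/-- A robot that is ready on a perimeter side can become ready on the next one. -/
theorem Ready.exists_robotPath {R : Finset Cell} (he : IsPerimeterSide S e) (h : Ready S cw e R) :
    ∃ R', Ready S cw (nextSide S cw e) R' ∧ RobotPath S (Sound S e) R R' := by
  have hR := h
  rcases h with ⟨hs, high, rfl⟩ | ⟨hs, high, rfl⟩
  · by_cases h1 : e.place cw (1, 1) ∈ S
    · rw [nextSide_of_mem h1]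
      -- Concave corner: the formation on the floor is already the one required at the lowest side
      -- of the wall.
      refine ⟨_, .inr ⟨hs.not_isStation_wall hA, high, ?_⟩, .refl (hR.sound hconn hA he)⟩
      rw [e.floor_wall cw]
    by_cases h2 : e.place cw (1, 0) ∈ S
    · rw [nextSide_of_notMem_of_mem h1 h2]
      exact ⟨_, .inl ⟨hs.shift hA h1 h2, _, rfl⟩, hs.robotPath_shift hconn hA h1 h2 high⟩
    · rw [nextSide_of_notMem_of_notMem h1 h2]
      exact ⟨_, .inl ⟨isStation_turn hA he fun x y hx hy => hs.notMem_ahead hA h2 hx hy, _, rfl⟩,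
        hs.robotPath_turn hconn hA h2 high⟩
  · have h1 := notMem_ahead_of_not_isStation hA he hs (x := 1) (y := 1) (by simp) le_rfl
    by_cases h2 : e.place cw (1, 0) ∈ S
    · rw [nextSide_of_notMem_of_mem h1 h2]
      refine ⟨_, .inr ⟨not_isStation_shift he hs, !high, rfl⟩, ?_⟩
      rw [e.floor_shift cw]
      exact robotPath_climb hconn hA he hs h2 high
    · rw [nextSide_of_notMem_of_notMem h1 h2]
      refine ⟨_, .inl ⟨isStation_top hA he hs h2, high, rfl⟩, ?_⟩
      have : (e.floor cw).place cw (1, 1) = e.place cw (0, 0) := by rw [Side.place_floor]; rfl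
      rw [← this]
      exact robotPath_top hconn hA he hs h2 high

end Step

/-! ### The colour of the load -/

/-- The parity of the number of robot nodes on black cells. -/
def colour (R : Finset Cell) : ZMod 2 := ∑ c ∈ R, ((c.1 + c.2 : ℤ) : ZMod 2)

theorem cast_vec (d : Dir) : ((d.vec.1 + d.vec.2 : ℤ) : ZMod 2) = 1 := by
  cases d <;> decide

/-- Both ends of a rotation are neighbours of the pivot, hence of equal colour. -/
theorem RobotMove.colour_eq {S R R' : Finset Cell} (h : RobotMove S R R') :
    colour R' = colour R := by
  obtain ⟨u, hu, w, ⟨-, v, -, d, d', -, hud, hwd, hw, -⟩, rfl⟩ := h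
  have huw : ((w.1 + w.2 : ℤ) : ZMod 2) = ((u.1 + u.2 : ℤ) : ZMod 2) := by
    have h1 := cast_vec d
    have h2 := cast_vec d'
    rw [hud, hwd]
    push_cast [Prod.fst_add, Prod.snd_add] at h1 h2 ⊢
    linear_combination h2 - h1
  have hwR : w ∉ R.erase u := fun h => hw (Finset.mem_union_right _ (Finset.mem_of_mem_erase h))
  rw [colour, colour, Finset.sum_insert hwR, huw,
    Finset.add_sum_erase R (fun c => ((c.1 + c.2 : ℤ) : ZMod 2)) hu]

theorem sevenRobot_high_unique {cw : Bool} {e : Side} {high high' : Bool}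
    (h : colour (sevenRobot cw e high) = colour (sevenRobot cw e high')) : high = high' := by
  have hplace : ∀ c, (((e.place cw c).1 + (e.place cw c).2 : ℤ) : ZMod 2) =
      ((e.base.1 + e.base.2 : ℤ) : ZMod 2) + ((c.1 + c.2 : ℤ) : ZMod 2) := by
    intro c
    have h1 := cast_vec (e.travel cw)
    have h2 := cast_vec e.dir
    simp only [Side.place, Prod.fst_add, Prod.snd_add, Prod.smul_fst, Prod.smul_snd, smul_eq_mul]
    push_cast at h1 h2 ⊢
    linear_combination (c.1 : ZMod 2) * h1 + (c.2 : ZMod 2) * h2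
  have hcolour : ∀ high, colour (sevenRobot cw e high) =
      7 * ((e.base.1 + e.base.2 : ℤ) : ZMod 2) + colour (standardRobot high) := by
    intro high
    have hcard : (standardRobot high).card = 7 := by cases high <;> rfl
    rw [sevenRobot_eq_image, colour, Finset.sum_image fun _ _ _ _ h => e.place_injective cw h,
      Finset.sum_congr rfl fun c _ => hplace c, Finset.sum_add_distrib, Finset.sum_const, hcard,
      nsmul_eq_mul, colour]
    norm_num
  rw [hcolour, hcolour, add_right_inj] at h
  have hne : colour (standardRobot true) ≠ colour (standardRobot false) := by decide +kernel
  cases high <;> cases high'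
  exacts [rfl, absurd h.symm hne, absurd h hne, rfl]

theorem IsStation.traversesPerimeter {S : Finset Cell} {cw : Bool} {e : Side}
    (hconn : ConnectedShape S) (hA : ConvexRegion (S : Set Cell)) (he : IsStation S cw e)
    (high : Bool) : TraversesPerimeter S cw e high := by
  have hper := he.1.iterate_nextSide (cw := cw) hA
  have hex : ∃ R : ℕ → Finset Cell, R 0 = sevenRobot cw e high ∧
      ∀ i, Ready S cw ((nextSide S cw)^[i] e) (R i) ∧
        RobotPath S (Sound S ((nextSide S cw)^[i] e)) (R i) (R (i + 1)) := by
    choose! next hnext using fun (e : Side) (R : Finset Cell) (he : IsPerimeterSide S e)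
      (h : Ready S cw e R) => h.exists_robotPath hconn hA he
    let R : ℕ → Finset Cell := fun i =>
      Nat.rec (sevenRobot cw e high) (fun i X => next ((nextSide S cw)^[i] e) X) i
    have hR : ∀ i, Ready S cw ((nextSide S cw)^[i] e) (R i) := by
      intro i
      induction i with
      | zero => exact .inl ⟨he, high, rfl⟩
      | succ i ih =>
        rw [Function.iterate_succ_apply']
        exact (hnext _ _ (hper i) ih).1
    exact ⟨R, rfl, fun i => ⟨hR i, (hnext _ _ (hper i) (hR i)).2⟩⟩
  obtain ⟨R, hR0, hR⟩ := hex
  have hperiodic := he.1.mem_periodicPts (cw := cw) hA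
  obtain ⟨T, τ, ρ, hτ0, hτm, hmono, hρR, hmove, hQ, hP⟩ :=
    RobotPath.join (fun X => Disjoint S X ∧ ConnectedShape (S ∪ X))
      (fun i => Sound S ((nextSide S cw)^[i] e)) R (fun _ _ h => h.1)
      ((hR 0).1.sound hconn hA he.1).1 (Function.minimalPeriod (nextSide S cw) e)
      fun i _ => (hR i).2
  set m := Function.minimalPeriod (nextSide S cw) e with hm
  have hloop : (nextSide S cw)^[m] e = e := Function.iterate_minimalPeriod
  have hform : ∀ i ≤ m, IsStation S cw ((nextSide S cw)^[i] e) →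
      ∃ high', ρ (τ i) = sevenRobot cw ((nextSide S cw)^[i] e) high' := by
    intro i hi hs
    rw [hρR i hi]
    rcases (hR i).1 with ⟨-, h⟩ | ⟨h, -⟩
    exacts [h, absurd hs h]
  have hstart : ρ 0 = sevenRobot cw e high := by rw [← hR0, ← hρR 0 (Nat.zero_le m), hτ0]
  refine ⟨m, T, τ, ρ, hloop, hper, ?_, hstart, ?_, hmove, hQ, hτ0, hτm, hmono, ?_, hform,
    fun i hi s h1 h2 => (hP i hi s h1 h2).2⟩
  · intro f hf
    obtain ⟨n, hn⟩ := he.1.exists_iterate_eq hA hf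
    refine ⟨n % m, ⟨Nat.mod_lt _ (Function.minimalPeriod_pos_of_mem_periodicPts hperiodic), ?_⟩, ?_⟩
    · rw [← hn, hm, Function.iterate_mod_minimalPeriod_eq]
    · rintro i ⟨hi, hif⟩
      refine Function.iterate_injOn_Iio_minimalPeriod hi
        (Nat.mod_lt _ (Function.minimalPeriod_pos_of_mem_periodicPts hperiodic)) ?_
      simp only
      rw [Function.iterate_mod_minimalPeriod_eq, hn, hif]
  -- After the lap the load could a priori be in either position; the invariant colour excludes the
  -- other one.
  · obtain ⟨high', h⟩ := hform m le_rfl (by rwa [hloop])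
    rw [hloop, hτm] at h
    have hcolour : ∀ s ≤ T, colour (ρ s) = colour (ρ 0) := by
      intro s
      induction s with
      | zero => exact fun _ => rfl
      | succ s ih => exact fun hs => (hmove s hs).colour_eq.trans (ih (by omega))
    have := hcolour T le_rfl
    rw [h, hstart] at this
    rw [h, sevenRobot_high_unique this]
  · intro i hi
    rw [hρR i hi]
    exact (hR i).1.outer_mem

theorem mainTheorem4 (S : Finset Cell) (hconn : ConnectedShape S) (hconv : OrthogonalConvex S)
    (clockwise : Bool) :
    (∃ e : Side, IsStation S clockwise e) ∧
    ∀ e : Side, IsStation S clockwise e →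
      ∀ high : Bool, TraversesPerimeter S clockwise e high := by
  have hA := convexRegion_coe hconn hconv
  have hne : S.Nonempty := by
    obtain ⟨⟨s, hs⟩⟩ := hconn.nonempty
    exact ⟨s, hs⟩
  exact ⟨exists_isStation hA hne, fun e he high => he.traversesPerimeter hconn hA high⟩
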